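/- Let $\Pi_G$ and $\Pi$ each be one of the three properties of finite simple undirected graphs: being planar, being bipartite, being triangle-free (the two properties may coincide). Consider the parameterized problem $P(G,\Pi_G,\Pi,k)$: an instance is a finite graph $G$ that has the property $\Pi_G$ together with an integer $k\ge 0$; the parameter is $k$; the question is whether there are $k$ vertices of $G$ that induce a subgraph with the property $\Pi$. Then $P(G,\Pi_G,\Pi,k)$ is fixed-parameter tractable: there are a Turing machine, a computable function $f:\mathbb N\to\mathbb N$ and a constant $c$ such that, on every instance $I=(G,k)$, with $G$ encoded by its adjacency matrix and $k$ in binary, the machine halts with the correct answer within $f(k)\cdot|I|^{c}$ steps, where $|I|$ is the length of the encoding in bits. Here a finite graph is planar if it has a combinatorial embedding in the sphere, that is, a rotation system (a cyclic order of the edges around each vertex) whose restriction to each connected component has genus zero. -/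

import Mathlib

/-! ### Graph properties -/

/-- A property of finite simple undirected graphs. -/
abbrev GraphProperty : Type 1 :=
  (V : Type) → [Finite V] → SimpleGraph V → Prop

namespace GraphProperty

variable {V : Type}

/-- The permutation of the darts (oriented edges) of `G` that reverses every dart. -/
def reverseDart (G : SimpleGraph V) : Equiv.Perm G.Dart :=
  (SimpleGraph.Dart.symm_involutive (G := G)).toPerm

/-- A rotation system of `G`: a permutation of the darts whose cycles are exactly the sets of darts
that leave a common vertex, that is, a cyclic order of the edges around each vertex. -/
def IsRotationSystem (G : SimpleGraph V) (rot : Equiv.Perm G.Dart) : Prop :=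
  ∀ d e : G.Dart, rot.SameCycle d e ↔ d.fst = e.fst

/-- The number of facial walks of a rotation system: the number of orbits of darts under
"traverse the dart, then turn to the next dart in the rotation at its head". -/
noncomputable def numFacialWalks (G : SimpleGraph V) (rot : Equiv.Perm G.Dart) : ℕ :=
  Nat.card (Quotient (Equiv.Perm.SameCycle.setoid (rot * reverseDart G)))

/-- The number of isolated vertices. -/
noncomputable def numIsolated (G : SimpleGraph V) : ℕ :=
  Nat.card {v : V // ∀ w, ¬ G.Adj v w}

/-- A finite graph is planar if it has a combinatorial embedding into the sphere, i.e. a rotation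
system of genus zero: Euler's relation `|V| - |E| + |F| = 2` holds in every connected component.
Since the genus of a rotation system is never negative in any component, this amounts to
`|V| - |E| + |F| = 2 |C|` overall, where each component has its own set of faces.
A component that is a single vertex has one face, which contains no dart. -/
def planar : GraphProperty := fun V _ G =>
  ∃ rot : Equiv.Perm G.Dart, IsRotationSystem G rot ∧
    Nat.card V + (numFacialWalks G rot + numIsolated G) =
      Nat.card G.edgeSet + 2 * Nat.card G.ConnectedComponent

/-- The property of being bipartite. -/
def bipartite : GraphProperty := fun _ _ G => G.IsBipartite

/-- The property of being triangle-free. -/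
def triangleFree : GraphProperty := fun _ _ G => G.CliqueFree 3

end GraphProperty

/-! ### Parameterized problems and fixed-parameter tractability -/

/-- A parameterized decision problem: a type of admissible instances, the bit string by which each
instance is given to an algorithm, its parameter, and the set of yes-instances. -/
structure ParameterizedProblem where
  Instance : Type
  encode : Instance → List Bool
  parameter : Instance → ℕ
  IsYes : Instance → Prop

open Classical in
/-- A parameterized problem is fixed-parameter tractable if a single (multi-stack) Turing machine,
started on the bit string of any instance, halts with the correct one-bit answer within
`f k * |I| ^ c` steps, where `k` is the parameter of the instance, `|I|` is the length of its bit
string, `f` is a computable function and `c` is a constant. -/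
def ParameterizedProblem.IsFPT (L : ParameterizedProblem) : Prop :=
  ∃ (M : Turing.TM2ComputableAux Bool Bool) (f : ℕ → ℕ) (c : ℕ), Computable f ∧
    ∀ I : L.Instance,
      Nonempty (Turing.TM2OutputsInTime M.tm
        ((L.encode I).map M.inputAlphabet.symm)
        (some ((Computability.encodeBool (decide (L.IsYes I))).map M.outputAlphabet.symm))
        (f (L.parameter I) * (L.encode I).length ^ c))

/-! ### The induced subgraph problem on a restricted class of inputs -/

open Classical in
/-- The adjacency matrix of a graph as a string of `n * n` bits, row by row. -/
noncomputable def adjacencyBits {n : ℕ} (G : SimpleGraph (Fin n)) : List Bool :=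
  (List.finRange n).flatMap fun i => (List.finRange n).map fun j => decide (G.Adj i j)

/-- An instance: a finite graph `G` with the property `PG`, and a natural number `k`. -/
structure InducedSubgraphInstance (PG : GraphProperty) where
  n : ℕ
  G : SimpleGraph (Fin n)
  mem : PG (Fin n) G
  k : ℕ

/-- The bit string of an instance: `n` ones and a zero, then the adjacency matrix of `G`,
then the binary digits of `k`. -/
noncomputable def InducedSubgraphInstance.encode {PG : GraphProperty}
    (I : InducedSubgraphInstance PG) : List Bool :=
  List.replicate I.n true ++ [false] ++ adjacencyBits I.G ++ Computability.encodeNat I.k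

/-- Given a graph `G` with property `PG` and a number `k`, the parameter, decide whether there are
`k` vertices of `G` that induce a subgraph with property `P`. -/
noncomputable def inducedSubgraphProblem (PG P : GraphProperty) : ParameterizedProblem where
  Instance := InducedSubgraphInstance PG
  encode := InducedSubgraphInstance.encode
  parameter := fun I => I.k
  IsYes := fun I => ∃ S : Finset (Fin I.n), S.card = I.k ∧
    P {v : Fin I.n // v ∈ S} (I.G.induce {v | v ∈ S})

/-! An edgeless graph has each of the three target properties, so `k` independent vertices already
make an instance positive. In a triangle-free (in particular, a bipartite) graph with at least `k ^
2` vertices they exist: either some neighbourhood contains `k` vertices, and it is independent, or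
all degrees are below `k` and a maximal independent set is large. In a planar graph with at least
`49 * k` vertices they exist as well, because Euler's relation bounds the number of edges linearly.
Hence every instance with `(k + 1) ^ 6 ≤ n` is positive (`exists_induce_of_large`).

The machine tests a cruder threshold. If `k` has `l` binary digits, then `(k + 1) ^ 6 ≤ 64 ^ l ≤ 64
^ k`, and `64 ^ l ≤ n` is tested by dividing `n` by `64` once for every digit of `k`. If the
quotient is positive, the machine accepts after polynomially many steps. Otherwise `n < 64 ^ k`, so
the length of the input is bounded in terms of `k`, and any decision procedure will do whose running
time is bounded by a computable function of the input length.

Such a procedure comes from recursion theory. Vertex sets, colourings and rotation systems are coded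
as digits of bounded numbers, so the problem becomes a primitive recursive predicate of the encoded
input (`exists_primrecPred_isYes`) and is decided by a compiled machine. "This machine halts within
`t` steps on all strings shorter than `m`" is again primitive recursive in `m` and `t`, so the least
such `t` is a computable function of `m` (`exists_computable_time`). The final machine joins the
size test to this brute force machine. -/

open SimpleGraph in
-- The closed neighbourhoods of a largest independent subset of `A` cover `A`, and each has at most
-- `d` elements.
theorem exists_isIndepSet_of_degree_lt {V : Type*} [Fintype V] [DecidableEq V] (G : SimpleGraph V)
    [DecidableRel G.Adj] (A : Finset V) (d : ℕ) (hd : ∀ v ∈ A, G.degree v < d) :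
    ∃ S ⊆ A, G.IsIndepSet (S : Set V) ∧ A.card ≤ d * S.card := by
  classical
  obtain ⟨S, hS, hmax⟩ :=
    (A.powerset.filter fun S : Finset V => G.IsIndepSet (S : Set V)).exists_max_image
    Finset.card ⟨∅, by simp [IsIndepSet]⟩
  simp only [Finset.mem_filter, Finset.mem_powerset] at hS hmax
  refine ⟨S, hS.1, hS.2, ?_⟩
  have hcov : A ⊆ S.biUnion fun s => insert s (G.neighborFinset s) := by
    intro v hv
    by_contra hcon
    simp only [Finset.mem_biUnion, Finset.mem_insert, mem_neighborFinset, not_exists, not_and,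
      not_or] at hcon
    have hvS : v ∉ S := fun h => (hcon v h).1 rfl
    have := hmax (insert v S) ⟨Finset.insert_subset hv hS.1, by
      rw [Finset.coe_insert, IsIndepSet, Set.pairwise_insert]
      exact ⟨hS.2, fun b hb _ => ⟨fun h => (hcon b hb).2 h.symm, (hcon b hb).2⟩⟩⟩
    rw [Finset.card_insert_of_notMem hvS] at this
    omega
  calc A.card ≤ _ := Finset.card_le_card hcov
    _ ≤ S.card * d := Finset.card_biUnion_le_card_mul _ _ _ fun s hs =>
        (Finset.card_insert_le _ _).trans (by simpa using hd s (hS.1 hs))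
    _ = _ := mul_comm _ _

/-! ### Large independent sets in planar, bipartite and triangle-free graphs. -/

namespace GraphProperty

theorem triangleFree_of_bipartite {V : Type} [Finite V] {G : SimpleGraph V} (h : bipartite V G) :
    triangleFree V G :=
  SimpleGraph.Colorable.cliqueFree (n := 2) h (by norm_num)

theorem exists_isIndepSet_of_triangleFree {V : Type} [Fintype V] {G : SimpleGraph V}
    (h : triangleFree V G) {k : ℕ} (hk : k ^ 2 ≤ Fintype.card V) :
    ∃ S : Finset V, S.card = k ∧ G.IsIndepSet (S : Set V) := by
  classical
  obtain hdeg | ⟨v, hv⟩ : (∀ v, G.degree v < k) ∨ ∃ v, k ≤ G.degree v := by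
    by_contra! hcon
    obtain ⟨⟨v, hv⟩, h2⟩ := hcon
    exact absurd (h2 v) (by omega)
  · obtain ⟨S, -, hS, hc⟩ := exists_isIndepSet_of_degree_lt G Finset.univ k fun v _ => hdeg v
    rw [Finset.card_univ] at hc
    have : k ≤ S.card := by
      rcases k.eq_zero_or_pos with rfl | hpos
      · simp
      · exact Nat.le_of_mul_le_mul_left (by nlinarith) hpos
    obtain ⟨T, hT, hTc⟩ := Finset.exists_subset_card_eq this
    exact ⟨T, hTc, hS.mono (by exact_mod_cast hT)⟩
  · obtain ⟨T, hT, hTc⟩ := Finset.exists_subset_card_eq (s := G.neighborFinset v) hv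
    refine ⟨T, hTc, fun a ha b hb hab hadj => ?_⟩
    have ha' := hT (Finset.mem_coe.1 ha)
    have hb' := hT (Finset.mem_coe.1 hb)
    rw [SimpleGraph.mem_neighborFinset] at ha' hb'
    exact h {v, a, b} (SimpleGraph.is3Clique_triple_iff.2 ⟨ha', hb', hadj⟩)

variable {V : Type}

@[simp]
theorem reverseDart_apply (G : SimpleGraph V) (d : G.Dart) : reverseDart G d = d.symm := rfl

theorem IsRotationSystem.apply_fst {G : SimpleGraph V} {rot : Equiv.Perm G.Dart}
    (h : IsRotationSystem G rot) (d : G.Dart) : (rot d).fst = d.fst :=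
  ((h d (rot d)).1 ⟨1, by simp⟩).symm

theorem IsRotationSystem.face_fst {G : SimpleGraph V} {rot : Equiv.Perm G.Dart}
    (h : IsRotationSystem G rot) (d : G.Dart) : ((rot * reverseDart G) d).fst = d.snd := by
  simp [h.apply_fst]

/-- A dart on a facial walk of length two spans a connected component, so it is the only dart that
leaves its tail. -/
theorem IsRotationSystem.eq_of_face_face {G : SimpleGraph V} {rot : Equiv.Perm G.Dart}
    (h : IsRotationSystem G rot) {d e : G.Dart}
    (hd : (rot * reverseDart G) ((rot * reverseDart G) d) = d) (hde : d.fst = e.fst) : d = e := by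
  -- Each dart of a facial walk starts where the previous one ends, so on a walk that closes after
  -- two steps the second dart is the reverse of the first. The rotation then fixes `d`.
  have h1 : (rot * reverseDart G) d = d.symm := by
    apply SimpleGraph.Dart.ext
    apply Prod.ext
    · exact h.face_fst d
    · have := h.face_fst ((rot * reverseDart G) d)
      rw [hd] at this
      exact this.symm
  have h2 : rot d = d := by
    rw [h1] at hd
    simpa using hd
  obtain ⟨i, hi⟩ := (h d e).2 hde
  rw [← hi]
  exact (Function.IsFixedPt.perm_zpow h2 i).symm

theorem numIsolated_le_card_connectedComponent [Finite V] (G : SimpleGraph V) :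
    numIsolated G ≤ Nat.card G.ConnectedComponent := by
  refine Nat.card_le_card_of_injective (fun v => G.connectedComponentMk v.1) ?_
  rintro ⟨v, hv⟩ ⟨w, hw⟩ hvw
  obtain ⟨p⟩ := SimpleGraph.ConnectedComponent.exact hvw
  cases p with
  | nil => rfl
  | cons hadj _ => exact absurd hadj (hv _)

/-- The lengths of the facial walks add up to the number of darts, which is twice the number of
edges. A walk with fewer than three darts has a representative that is the only dart at its tail, so
there are at most as many short walks as vertices; each is credited with three extra darts. -/
theorem IsRotationSystem.three_mul_numFacialWalks_le [Finite V] {G : SimpleGraph V}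
    {rot : Equiv.Perm G.Dart} (h : IsRotationSystem G rot) :
    3 * numFacialWalks G rot ≤ 2 * Nat.card G.edgeSet + 3 * Nat.card V := by
  classical
  have := Fintype.ofFinite V
  set φ := rot * reverseDart G with hφ
  let s := Equiv.Perm.SameCycle.setoid φ
  have hne : ∀ d, φ d ≠ d := fun d hd => by
    have := h.face_fst d
    rw [← hφ, hd] at this
    exact d.adj.ne this
  let Q := Quotient s
  let fib : Q → Finset G.Dart := fun q => Finset.univ.filter fun d => Quotient.mk s d = q
  have hmem : ∀ d, φ d ∈ fib (Quotient.mk s d) := fun d => by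
    simp only [fib, Finset.mem_filter, Finset.mem_univ, true_and]
    exact Quotient.sound (Equiv.Perm.SameCycle.symm ⟨1, by simp⟩)
  -- Since `φ` has no fixed point, a representative and its first two images are distinct unless the
  -- second image is the representative itself.
  have hsmall : ∀ q : Q, (fib q).card < 3 → φ (φ q.out) = q.out := by
    intro q hq
    by_contra hcon
    have hq1 : φ q.out ∈ fib q := by simpa using hmem q.out
    have hq2 : φ (φ q.out) ∈ fib q := by
      have := hmem (φ q.out)
      rwa [(Finset.mem_filter.1 hq1).2] at this
    have hsub : {q.out, φ q.out, φ (φ q.out)} ⊆ fib q := by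
      intro d hd
      simp only [Finset.mem_insert, Finset.mem_singleton] at hd
      rcases hd with rfl | rfl | rfl
      · simp [fib]
      · exact hq1
      · exact hq2
    have := Finset.card_le_card hsub
    rw [Finset.card_eq_three.2 ⟨_, _, _, (hne _).symm, Ne.symm hcon, (hne _).symm, rfl⟩] at this
    omega
  have hsum : ∑ q : Q, (fib q).card = 2 * Nat.card G.edgeSet := by
    rw [← Finset.card_eq_sum_card_fiberwise (fun _ _ => Finset.mem_coe.2 (Finset.mem_univ _)),
      Finset.card_univ, G.dart_card_eq_twice_card_edges, Nat.card_eq_fintype_card,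
      SimpleGraph.edgeFinset_card]
  have hfew : (Finset.univ.filter fun q : Q => (fib q).card < 3).card ≤ Nat.card V := by
    rw [Nat.card_eq_fintype_card, ← Finset.card_univ]
    refine Finset.card_le_card_of_injOn (fun q => q.out.fst) (fun _ _ => Finset.mem_univ _) ?_
    intro q hq r hr hqr
    have := h.eq_of_face_face (hsmall q (Finset.mem_filter.1 hq).2) hqr
    rw [← q.out_eq, ← r.out_eq, this]
  have hF : numFacialWalks G rot = Fintype.card Q := Nat.card_eq_fintype_card
  have hpt : ∑ _q : Q, 3 ≤ ∑ q : Q, ((fib q).card + if (fib q).card < 3 then 3 else 0) :=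
    Finset.sum_le_sum fun q _ => by split_ifs <;> omega
  rw [Finset.sum_add_distrib, hsum, ← Finset.sum_filter, Finset.sum_const, Finset.sum_const,
    Finset.card_univ, ← hF, smul_eq_mul, smul_eq_mul] at hpt
  omega

/-- Three times Euler's relation, combined with the face bound `3F ≤ 2E + 3V` and the fact that
there are no more isolated vertices than components, leaves `E ≤ 6V`. Any linear bound would serve,
so the sharp one is not needed. -/
theorem card_edgeSet_le_of_planar [Finite V] {G : SimpleGraph V} (h : planar V G) :
    Nat.card G.edgeSet ≤ 6 * Nat.card V := by
  obtain ⟨rot, hrot, heuler⟩ := h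
  have h1 := hrot.three_mul_numFacialWalks_le
  have h2 := numIsolated_le_card_connectedComponent G
  omega

/-- The degrees sum to at most `12n`, so at most `12n/25` vertices have degree 25 or more. The other
`13n/25` vertices contain an independent set of at least `13n/625` vertices, and `13 * 49 ≥ 625`. -/
theorem exists_isIndepSet_of_planar [Fintype V] {G : SimpleGraph V}
    (h : planar V G) {k : ℕ} (hk : 49 * k ≤ Fintype.card V) :
    ∃ S : Finset V, S.card = k ∧ G.IsIndepSet (S : Set V) := by
  classical
  have hE := card_edgeSet_le_of_planar h
  rw [Nat.card_eq_fintype_card, Nat.card_eq_fintype_card, ← SimpleGraph.edgeFinset_card] at hE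
  have hdeg := G.sum_degrees_eq_twice_card_edges
  let A := Finset.univ.filter fun v => G.degree v < 25
  have hA : 25 * (Fintype.card V - A.card) ≤ 12 * Fintype.card V := by
    have hc : Fintype.card V - A.card = (Finset.univ.filter fun v => ¬ G.degree v < 25).card := by
      have := Finset.card_filter_add_card_filter_not (s := (Finset.univ : Finset V))
        (fun v => G.degree v < 25)
      rw [Finset.card_univ] at this
      simp only [A]
      omega
    rw [hc, mul_comm]
    calc _ ≤ ∑ v ∈ Finset.univ.filter (fun v => ¬ G.degree v < 25), G.degree v :=
          Finset.card_nsmul_le_sum _ _ _ fun v hv => by simpa using hv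
      _ ≤ ∑ v, G.degree v := Finset.sum_le_sum_of_subset (Finset.filter_subset _ _)
      _ ≤ _ := by omega
  obtain ⟨S, -, hS, hc⟩ := exists_isIndepSet_of_degree_lt G A 25 fun v hv => by simpa [A] using hv
  obtain ⟨T, hT, hTc⟩ := Finset.exists_subset_card_eq (show k ≤ S.card by omega)
  exact ⟨T, hTc, hS.mono (by exact_mod_cast hT)⟩

theorem bot_of_eq {P : GraphProperty} (hP : P = planar ∨ P = bipartite ∨ P = triangleFree)
    [Finite V] : P V ⊥ := by
  classical
  rcases hP with rfl | rfl | rfl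
  · have : IsEmpty (⊥ : SimpleGraph V).Dart := ⟨fun d => d.adj⟩
    refine ⟨1, fun d => isEmptyElim d, ?_⟩
    have h1 : numFacialWalks (⊥ : SimpleGraph V) 1 = 0 := by
      unfold numFacialWalks
      have : IsEmpty
          (Quotient (Equiv.Perm.SameCycle.setoid (1 * reverseDart (⊥ : SimpleGraph V)))) :=
        ⟨fun q => Quotient.inductionOn q fun d => isEmptyElim d⟩
      exact Nat.card_of_isEmpty
    have h2 : numIsolated (⊥ : SimpleGraph V) = Nat.card V :=
      Nat.card_congr (Equiv.subtypeUnivEquiv fun v w => by simp)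
    have h3 : Nat.card (⊥ : SimpleGraph V).ConnectedComponent = Nat.card V := by
      refine (Nat.card_congr (Equiv.ofBijective (⊥ : SimpleGraph V).connectedComponentMk
        ⟨fun v w h => ?_, Quot.mk_surjective⟩)).symm
      simpa using SimpleGraph.ConnectedComponent.exact h
    rw [h1, h2, h3]
    simp
    omega
  · exact ⟨SimpleGraph.Coloring.mk (fun _ => 0) fun h => absurd h (by simp)⟩
  · exact SimpleGraph.cliqueFree_bot (by norm_num)

theorem exists_induce_of_large {PG P : GraphProperty}
    (hPG : PG = planar ∨ PG = bipartite ∨ PG = triangleFree)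
    (hP : P = planar ∨ P = bipartite ∨ P = triangleFree) {n k : ℕ} {G : SimpleGraph (Fin n)}
    (hG : PG (Fin n) G) (hn : (k + 1) ^ 6 ≤ n) :
    ∃ S : Finset (Fin n), S.card = k ∧
      P {v : Fin n // v ∈ S} (G.induce {v | v ∈ S}) := by
  have h1 : k ^ 2 ≤ n :=
    ((Nat.pow_le_pow_left k.le_succ 2).trans
      (Nat.pow_le_pow_right k.succ_pos (by norm_num))).trans hn
  have h2 : 49 * k ≤ n := by
    refine le_trans ?_ hn
    -- The nonconstant coefficients of `(k + 1) ^ 6` add up to `2 ^ 6 - 1 = 63`, which is at least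
    -- 49; exponent five would give only 31.
    have hp : ∀ i ≠ 0, k ≤ k ^ i := fun i hi => Nat.le_self_pow hi k
    have := hp 2; have := hp 3; have := hp 4; have := hp 5; have := hp 6
    ring_nf
    omega
  obtain ⟨S, hc, hS⟩ : ∃ S : Finset (Fin n), S.card = k ∧ G.IsIndepSet (S : Set (Fin n)) := by
    rcases hPG with rfl | rfl | rfl
    · exact exists_isIndepSet_of_planar hG (by simpa using h2)
    · exact exists_isIndepSet_of_triangleFree (triangleFree_of_bipartite hG) (by simpa using h1)
    · exact exists_isIndepSet_of_triangleFree hG (by simpa using h1)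
  refine ⟨S, hc, ?_⟩
  have : G.induce {v | v ∈ S} = ⊥ := by
    ext v w
    simp only [SimpleGraph.comap_adj, SimpleGraph.bot_adj, iff_false]
    exact fun h => hS v.2 w.2 h.ne h
  rw [this]
  exact bot_of_eq hP

end GraphProperty

/-! ### Graph properties in terms of natural numbers -/

/-- The `i`-th digit of `R` in base `b`. -/
def natDigit (b R i : ℕ) : ℕ := R / b ^ i % b

/-- This turns a quantifier over functions between finite sets into a bounded quantifier over
numbers. -/
theorem exists_natDigit_eq {b m : ℕ} (g : ℕ → ℕ) (hg : ∀ i < m, g i < b) :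
    ∃ R < b ^ m, ∀ i < m, natDigit b R i = g i := by
  let h : Fin m → Fin b := fun i => ⟨g i, hg i i.2⟩
  refine ⟨finFunctionFinEquiv h, (finFunctionFinEquiv h).2, fun i hi => ?_⟩
  have := congrArg Fin.val (congrFun (finFunctionFinEquiv.symm_apply_apply h) ⟨i, hi⟩)
  rwa [finFunctionFinEquiv_symm_apply_val] at this

theorem exists_natDigit_two_iff {m : ℕ} (p : ℕ → Prop) :
    ∃ R < 2 ^ m, ∀ i < m, natDigit 2 R i = 1 ↔ p i := by
  classical
  obtain ⟨R, hR, h⟩ := exists_natDigit_eq (b := 2) (m := m) (fun i => if p i then 1 else 0)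
    fun i _ => by split_ifs <;> norm_num
  exact ⟨R, hR, fun i hi => by rw [h i hi]; split_ifs <;> simp_all⟩

/-- The number of `i < n` that satisfy `p`. -/
noncomputable def natCount (n : ℕ) (p : ℕ → Prop) : ℕ := Nat.card {i // i < n ∧ p i}

theorem natCount_eq {α : Type*} {f : α → ℕ} (hf : f.Injective) {n : ℕ} (hlt : ∀ a, f a < n)
    {p : α → Prop} {q : ℕ → Prop} (hpq : ∀ a, q (f a) ↔ p a)
    (hsurj : ∀ i < n, q i → ∃ a, f a = i) : natCount n q = Nat.card {a // p a} := by
  refine (Nat.card_congr (Equiv.ofBijective (fun a : {a // p a} => ⟨f a.1, hlt _, (hpq _).2 a.2⟩)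
    ⟨fun a b h => Subtype.ext (hf (congrArg Subtype.val h)), ?_⟩)).symm
  rintro ⟨i, hi, hq⟩
  obtain ⟨a, rfl⟩ := hsurj i hi hq
  exact ⟨⟨a, (hpq a).1 hq⟩, rfl⟩

/-- Each class has exactly one element of least code. Faces and components can thus be counted
without forming a quotient. -/
theorem Quotient.card_eq_card_minimal {α : Type*} (s : Setoid α) {f : α → ℕ}
    (hf : f.Injective) : Nat.card (Quotient s) = Nat.card {x // ∀ y, s x y → f x ≤ f y} := by
  refine (Nat.card_congr (Equiv.ofBijective
    (fun x : {x // ∀ y, s x y → f x ≤ f y} => Quotient.mk s x.1) ⟨?_, ?_⟩)).symm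
  · intro x y h
    have h' : s x.1 y.1 := Quotient.exact h
    exact Subtype.ext (hf (le_antisymm (x.2 _ h') (y.2 _ (s.symm h'))))
  · intro q
    induction q using Quotient.inductionOn with
    | h a =>
      have hne : (f '' {y | s a y}).Nonempty := ⟨f a, a, s.refl a, rfl⟩
      obtain ⟨x, hx, hxe⟩ := Nat.sInf_mem hne
      refine ⟨⟨x, fun y hy => ?_⟩, Quotient.sound (s.symm hx)⟩
      rw [hxe]
      exact Nat.sInf_le ⟨y, s.trans hx hy, rfl⟩

/-- The relation `a` on the numbers `i < n` with `s i` is a copy of the graph `G`, in which the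
vertex `v` is represented by the number `f v`. -/
structure IsNatCopy {V : Type} (G : SimpleGraph V) (n : ℕ) (s : ℕ → Prop) (a : ℕ → ℕ → Prop)
    (f : V → ℕ) : Prop where
  inj : f.Injective
  lt : ∀ v, f v < n
  mem : ∀ v, s (f v)
  surj : ∀ i < n, s i → ∃ v, f v = i
  adj : ∀ u v, a (f u) (f v) ↔ G.Adj u v
  left : ∀ i j, a i j → s i
  right : ∀ i j, a i j → s j

/-- The relation `a` on the numbers less than `n` contains no triangle. -/
def NatTriangleFree (n : ℕ) (a : ℕ → ℕ → Prop) : Prop :=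
  ∀ i < n, ∀ j < n, ∀ l < n, ¬ (a i j ∧ a i l ∧ a j l)

/-- The relation `a` on the numbers less than `n` has a proper colouring with two colours. -/
def NatBipartite (n : ℕ) (a : ℕ → ℕ → Prop) : Prop :=
  ∃ T < 2 ^ n, ∀ i < n, ∀ j < n, a i j → natDigit 2 T i ≠ natDigit 2 T j

/-- The number `d` represents the dart from `d / n` to `d % n`. -/
def NatIsDart (n : ℕ) (a : ℕ → ℕ → Prop) (d : ℕ) : Prop := a (d / n) (d % n)

/-- The digits of `R` list the values of a rotation system. -/
def natRot (n R d : ℕ) : ℕ := natDigit (n ^ 2) R d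

/-- One step along a facial walk of the rotation system `R`. -/
def natFace (n R d : ℕ) : ℕ := natRot n R (d % n * n + d / n)

/-- The digits of `R` list the values of a rotation system of genus zero. -/
def NatSpherical (n : ℕ) (s : ℕ → Prop) (a : ℕ → ℕ → Prop) (R : ℕ) : Prop :=
  (∀ d < n ^ 2, NatIsDart n a d → NatIsDart n a (natRot n R d)) ∧
  (∀ d < n ^ 2, ∀ e < n ^ 2, NatIsDart n a d → NatIsDart n a e →
    ((∃ t < n ^ 2 + 2, (natRot n R)^[t] d = e) ↔ d / n = e / n)) ∧
  2 * (natCount n s +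
      (natCount (n ^ 2) (fun d => NatIsDart n a d ∧ ∀ t < n ^ 2 + 2, d ≤ (natFace n R)^[t] d) +
        natCount n fun v => s v ∧ ∀ w < n, ¬ a v w)) =
    natCount (n ^ 2) (NatIsDart n a) +
      4 * natCount n fun v => s v ∧ ∀ u < v, ∃ T < 2 ^ n,
        natDigit 2 T v = 1 ∧ ¬ natDigit 2 T u = 1 ∧
        ∀ i < n, ∀ j < n, natDigit 2 T i = 1 → a i j → natDigit 2 T j = 1

/-- The relation `a` on the numbers `i < n` with `s i` is a planar graph. -/
def NatPlanar (n : ℕ) (s : ℕ → Prop) (a : ℕ → ℕ → Prop) : Prop :=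
  ∃ R < (n ^ 2) ^ (n ^ 2), NatSpherical n s a R

/-! ### The three graph properties transported along a numbering of the vertices. -/

namespace IsNatCopy

open GraphProperty

variable {V : Type} {G : SimpleGraph V} {n : ℕ} {s : ℕ → Prop} {a : ℕ → ℕ → Prop} {f : V → ℕ}

theorem exists_adj (h : IsNatCopy G n s a f) {i j : ℕ} (hi : i < n) (hj : j < n) (hij : a i j) :
    ∃ u v, f u = i ∧ f v = j ∧ G.Adj u v := by
  obtain ⟨u, rfl⟩ := h.surj i hi (h.left _ _ hij)
  obtain ⟨v, rfl⟩ := h.surj j hj (h.right _ _ hij)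
  exact ⟨u, v, rfl, rfl, (h.adj u v).1 hij⟩

theorem finite (h : IsNatCopy G n s a f) : Finite V :=
  Finite.of_injective (fun v => (⟨f v, h.lt v⟩ : Fin n))
    fun _ _ huv => h.inj (congrArg Fin.val huv)

theorem triangleFree_iff (h : IsNatCopy G n s a f) [Finite V] :
    triangleFree V G ↔ NatTriangleFree n a := by
  classical
  constructor
  · rintro hG i hi j hj l hl ⟨h1, h2, h3⟩
    obtain ⟨u, v, rfl, rfl, huv⟩ := h.exists_adj hi hj h1
    obtain ⟨w, rfl⟩ := h.surj l hl (h.right _ _ h2)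
    exact hG {u, v, w} (SimpleGraph.is3Clique_triple_iff.2
      ⟨huv, (h.adj _ _).1 h2, (h.adj _ _).1 h3⟩)
  · intro hN S hS
    obtain ⟨u, v, w, huv, huw, hvw, -⟩ := SimpleGraph.is3Clique_iff.1 hS
    exact hN _ (h.lt u) _ (h.lt v) _ (h.lt w)
      ⟨(h.adj _ _).2 huv, (h.adj _ _).2 huw, (h.adj _ _).2 hvw⟩

theorem bipartite_iff (h : IsNatCopy G n s a f) [Finite V] :
    bipartite V G ↔ NatBipartite n a := by
  constructor
  · rintro ⟨c⟩
    obtain ⟨T, hT, hTc⟩ := exists_natDigit_two_iff (m := n) fun i => ∃ v, f v = i ∧ c v = 1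
    refine ⟨T, hT, fun i hi j hj hij heq => ?_⟩
    obtain ⟨u, v, rfl, rfl, huv⟩ := h.exists_adj hi hj hij
    have hval : ∀ v, natDigit 2 T (f v) = 1 ↔ c v = 1 := fun v => by
      rw [hTc _ (h.lt v)]
      exact ⟨fun ⟨w, hw, hc⟩ => h.inj hw ▸ hc, fun hc => ⟨v, rfl, hc⟩⟩
    have hne := c.valid huv
    have h1 := hval u
    have h2 := hval v
    rw [heq, h2] at h1
    omega
  · rintro ⟨T, -, hT⟩
    refine ⟨SimpleGraph.Coloring.mk
      (fun v => (⟨natDigit 2 T (f v), Nat.mod_lt _ two_pos⟩ : Fin 2)) fun {u v} huv heq => ?_⟩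
    exact hT _ (h.lt u) _ (h.lt v) ((h.adj _ _).2 huv) (congrArg Fin.val heq)

/-- The number that represents a dart. -/
def dartCode (_ : IsNatCopy G n s a f) (d : G.Dart) : ℕ := f d.fst * n + f d.snd

theorem dartCode_div (h : IsNatCopy G n s a f) (d : G.Dart) : h.dartCode d / n = f d.fst := by
  have := h.lt d.snd
  rw [dartCode, mul_comm, Nat.mul_add_div (by omega), Nat.div_eq_of_lt this, add_zero]

theorem dartCode_mod (h : IsNatCopy G n s a f) (d : G.Dart) : h.dartCode d % n = f d.snd := by
  rw [dartCode, mul_comm, Nat.mul_add_mod, Nat.mod_eq_of_lt (h.lt _)]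

theorem dartCode_lt (h : IsNatCopy G n s a f) (d : G.Dart) : h.dartCode d < n ^ 2 := by
  have h1 := h.lt d.fst
  have h2 := h.lt d.snd
  rw [dartCode]
  nlinarith

theorem dartCode_injective (h : IsNatCopy G n s a f) : h.dartCode.Injective := fun d e hde => by
  apply SimpleGraph.Dart.ext
  apply Prod.ext
  · exact h.inj (by rw [← h.dartCode_div d, ← h.dartCode_div e, hde])
  · exact h.inj (by rw [← h.dartCode_mod d, ← h.dartCode_mod e, hde])

theorem natIsDart_dartCode (h : IsNatCopy G n s a f) (d : G.Dart) :
    NatIsDart n a (h.dartCode d) := by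
  rw [NatIsDart, h.dartCode_div, h.dartCode_mod]
  exact (h.adj _ _).2 d.adj

theorem exists_dartCode_eq (h : IsNatCopy G n s a f) {d : ℕ} (hd : d < n ^ 2)
    (hdart : NatIsDart n a d) : ∃ e, h.dartCode e = d := by
  have hn : 0 < n := by
    rcases n.eq_zero_or_pos with rfl | hn
    · simp at hd
    · exact hn
  obtain ⟨u, v, hu, hv, huv⟩ := h.exists_adj (Nat.div_lt_of_lt_mul (by rwa [← sq]))
    (Nat.mod_lt d hn) hdart
  refine ⟨⟨(u, v), huv⟩, ?_⟩
  change f u * n + f v = d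
  rw [hu, hv, Nat.div_add_mod']

/-- A cycle of darts has at most `n ^ 2` elements, so lying on a common cycle can be checked with
boundedly many iterations. The extra `2` absorbs the slack in the exponent that `exists_pow_eq`
provides. -/
theorem sameCycle_iff (h : IsNatCopy G n s a f) (σ : Equiv.Perm G.Dart) {g : ℕ → ℕ}
    (hg : ∀ d, g (h.dartCode d) = h.dartCode (σ d)) (d e : G.Dart) :
    (∃ t < n ^ 2 + 2, g^[t] (h.dartCode d) = h.dartCode e) ↔ σ.SameCycle d e := by
  classical
  have := h.finite
  have := Fintype.ofFinite V
  have hit : ∀ t, g^[t] (h.dartCode d) = h.dartCode ((σ ^ t) d) := by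
    intro t
    induction t with
    | zero => rfl
    | succ t ih => rw [Function.iterate_succ_apply', ih, hg, pow_succ', Equiv.Perm.mul_apply]
  constructor
  · rintro ⟨t, -, ht⟩
    rw [hit] at ht
    exact ⟨t, by simpa using h.dartCode_injective ht⟩
  · intro hs
    obtain ⟨t, -, ht, hte⟩ := hs.exists_pow_eq
    refine ⟨t, ?_, by rw [hit, hte]⟩
    have h1 : (σ.cycleOf d).support.card ≤ Fintype.card G.Dart := Finset.card_le_univ _
    have h2 : Fintype.card G.Dart ≤ n ^ 2 := by
      simpa using Fintype.card_le_of_injective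
        (fun d => (⟨h.dartCode d, h.dartCode_lt d⟩ : Fin (n ^ 2)))
        fun _ _ hde => h.dartCode_injective (congrArg Fin.val hde)
    omega

theorem natCount_vertices (h : IsNatCopy G n s a f) : natCount n s = Nat.card V := by
  rw [natCount_eq h.inj h.lt (p := fun _ => True) (fun v => iff_of_true (h.mem v) trivial) h.surj]
  exact Nat.card_congr (Equiv.subtypeUnivEquiv fun _ => trivial)

theorem natCount_isolated (h : IsNatCopy G n s a f) :
    (natCount n fun v => s v ∧ ∀ w < n, ¬ a v w) = numIsolated G := by
  refine natCount_eq h.inj h.lt (fun v => ?_) fun i hi hs => h.surj i hi hs.1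
  refine ⟨fun hv w hw => hv.2 _ (h.lt w) ((h.adj _ _).2 hw),
    fun hv => ⟨h.mem v, fun w hw hvw => ?_⟩⟩
  obtain ⟨w, rfl⟩ := h.surj w hw (h.right _ _ hvw)
  exact hv w ((h.adj _ _).1 hvw)

theorem natCount_darts (h : IsNatCopy G n s a f) :
    natCount (n ^ 2) (NatIsDart n a) = 2 * Nat.card G.edgeSet := by
  classical
  have := h.finite
  have := Fintype.ofFinite V
  rw [natCount_eq h.dartCode_injective h.dartCode_lt (p := fun _ => True)
    (fun d => iff_of_true (h.natIsDart_dartCode d) trivial) fun _ => h.exists_dartCode_eq,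
    Nat.card_congr (Equiv.subtypeUnivEquiv fun _ => trivial), Nat.card_eq_fintype_card,
    G.dart_card_eq_twice_card_edges, Nat.card_eq_fintype_card, SimpleGraph.edgeFinset_card]

theorem natCount_faces (h : IsNatCopy G n s a f) (rot : Equiv.Perm G.Dart) {R : ℕ}
    (hR : ∀ d, natRot n R (h.dartCode d) = h.dartCode (rot d)) :
    natCount (n ^ 2) (fun d => NatIsDart n a d ∧ ∀ t < n ^ 2 + 2, d ≤ (natFace n R)^[t] d) =
      numFacialWalks G rot := by
  have hg : ∀ d, natFace n R (h.dartCode d) = h.dartCode ((rot * reverseDart G) d) := by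
    intro d
    rw [natFace, h.dartCode_div, h.dartCode_mod]
    exact hR d.symm
  rw [numFacialWalks, Quotient.card_eq_card_minimal _ h.dartCode_injective]
  refine natCount_eq h.dartCode_injective h.dartCode_lt (fun d => ?_)
    fun i hi hd => h.exists_dartCode_eq hi hd.1
  refine ⟨fun hd e hde => ?_, fun hd => ⟨h.natIsDart_dartCode d, fun t ht => ?_⟩⟩
  · obtain ⟨t, ht, hte⟩ := (h.sameCycle_iff _ hg d e).2 hde
    exact hte ▸ hd.2 t ht
  · have : ∃ e, h.dartCode e = (natFace n R)^[t] (h.dartCode d) := by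
      clear ht
      induction t with
      | zero => exact ⟨d, rfl⟩
      | succ t ih =>
        obtain ⟨e, he⟩ := ih
        exact ⟨_, by rw [Function.iterate_succ_apply', ← he, hg]⟩
    obtain ⟨e, he⟩ := this
    rw [← he]
    exact hd e ((h.sameCycle_iff _ hg d e).1 ⟨t, ht, he.symm⟩)

/-- Reachability is expressed through its complement: `u` lies outside the component of `v` if and
only if some set closed under adjacency contains `v` but not `u`. The condition thus selects the
least vertex of each component. -/
theorem natCount_components (h : IsNatCopy G n s a f) :
    (natCount n fun v => s v ∧ ∀ u < v, ∃ T < 2 ^ n, natDigit 2 T v = 1 ∧ ¬ natDigit 2 T u = 1 ∧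
        ∀ i < n, ∀ j < n, natDigit 2 T i = 1 → a i j → natDigit 2 T j = 1) =
      Nat.card G.ConnectedComponent := by
  rw [show Nat.card G.ConnectedComponent = Nat.card (Quotient G.reachableSetoid) from rfl,
    Quotient.card_eq_card_minimal _ h.inj]
  refine natCount_eq h.inj h.lt (fun v => ?_) fun i hi hs => h.surj i hi hs.1
  constructor
  · intro hv w hvw
    by_contra! hlt
    obtain ⟨T, -, hTv, hTw, hT⟩ := hv.2 _ hlt
    obtain ⟨p⟩ : G.Reachable v w := hvw
    clear hlt hv
    induction p with
    | nil => exact hTw hTv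
    | cons hadj _ ih =>
      exact ih (hT _ (h.lt _) _ (h.lt _) hTv ((h.adj _ _).2 hadj)) hTw
  · intro hv
    refine ⟨h.mem v, fun u hu => ?_⟩
    -- The separating set is the component of `v`; it also excludes numbers that represent no
    -- vertex.
    obtain ⟨T, hT2, hT⟩ := exists_natDigit_two_iff (m := n) fun i => ∃ w, f w = i ∧ G.Reachable v w
    refine ⟨T, hT2, (hT _ (h.lt v)).2 ⟨v, rfl, .refl v⟩, fun hTu => ?_, fun i hi j hj hTi hij => ?_⟩
    · obtain ⟨w, rfl, hw⟩ := (hT _ (hu.trans (h.lt v))).1 hTu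
      exact absurd (hv w hw) (by omega)
    · obtain ⟨w, rfl, hw⟩ := (hT _ hi).1 hTi
      obtain ⟨x, y, hx, rfl, hxy⟩ := h.exists_adj hi hj hij
      obtain rfl := h.inj hx
      exact (hT _ hj).2 ⟨y, rfl, hw.trans hxy.reachable⟩

/-- A permutation of the darts is stored as its table of values in base `n ^ 2`. The Euler relation
appears doubled in `NatSpherical` because darts are counted there in place of edges. -/
theorem planar_iff (h : IsNatCopy G n s a f) [Finite V] : planar V G ↔ NatPlanar n s a := by
  have key : ∀ (rot : Equiv.Perm G.Dart) (R : ℕ),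
      (∀ d, natRot n R (h.dartCode d) = h.dartCode (rot d)) →
      (NatSpherical n s a R ↔ IsRotationSystem G rot ∧
        Nat.card V + (numFacialWalks G rot + numIsolated G) =
          Nat.card G.edgeSet + 2 * Nat.card G.ConnectedComponent) := by
    intro rot R hR
    rw [NatSpherical, h.natCount_vertices, h.natCount_isolated, h.natCount_darts,
      h.natCount_faces rot hR, h.natCount_components]
    constructor
    · rintro ⟨-, h2, h3⟩
      refine ⟨fun d e => ?_, by omega⟩
      rw [← h.sameCycle_iff rot hR, h2 _ (h.dartCode_lt d) _ (h.dartCode_lt e)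
        (h.natIsDart_dartCode d) (h.natIsDart_dartCode e), h.dartCode_div, h.dartCode_div,
        h.inj.eq_iff]
    · rintro ⟨hrot, h3⟩
      refine ⟨fun d hd hdart => ?_, fun d hd e he hdart hedart => ?_, by omega⟩
      · obtain ⟨d, rfl⟩ := h.exists_dartCode_eq hd hdart
        rw [hR]
        exact h.natIsDart_dartCode _
      · obtain ⟨d, rfl⟩ := h.exists_dartCode_eq hd hdart
        obtain ⟨e, rfl⟩ := h.exists_dartCode_eq he hedart
        rw [h.sameCycle_iff rot hR, hrot, h.dartCode_div, h.dartCode_div, h.inj.eq_iff]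
  constructor
  · rintro ⟨rot, hrot⟩
    classical
    obtain ⟨R, hR, hRd⟩ := exists_natDigit_eq (b := n ^ 2) (m := n ^ 2)
      (fun i => if hi : ∃ d, h.dartCode d = i then h.dartCode (rot hi.choose) else 0) fun i hi => by
        split_ifs
        · exact h.dartCode_lt _
        · omega
    refine ⟨R, hR, (key rot R fun d => ?_).2 hrot⟩
    have hd : ∃ e, h.dartCode e = h.dartCode d := ⟨d, rfl⟩
    rw [natRot, hRd _ (h.dartCode_lt d), dif_pos hd, h.dartCode_injective hd.choose_spec]
  · rintro ⟨R, -, hR⟩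
    have hlt : ∀ d, natRot n R (h.dartCode d) < n ^ 2 := fun d =>
      Nat.mod_lt _ (Nat.zero_lt_of_lt (h.dartCode_lt d))
    choose r hr using fun d => h.exists_dartCode_eq (hlt d)
      (hR.1 _ (h.dartCode_lt d) (h.natIsDart_dartCode d))
    have hit : ∀ t d, (natRot n R)^[t] (h.dartCode d) = h.dartCode (r^[t] d) := by
      intro t d
      induction t with
      | zero => rfl
      | succ t ih => rw [Function.iterate_succ_apply', ih, ← hr, Function.iterate_succ_apply']
    have hcyc : ∀ d e : G.Dart,
        (∃ t < n ^ 2 + 2, (natRot n R)^[t] (h.dartCode d) = h.dartCode e) ↔ d.fst = e.fst := by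
      intro d e
      rw [hR.2.1 _ (h.dartCode_lt d) _ (h.dartCode_lt e) (h.natIsDart_dartCode d)
        (h.natIsDart_dartCode e), h.dartCode_div, h.dartCode_div, h.inj.eq_iff]
    -- A coded rotation is not required to be a permutation. As `r e` and `e` have the same tail,
    -- some iterate of `r` leads from `r e` back to `e`, which puts `e` in the range of `r`;
    -- finiteness then gives bijectivity.
    have hsurj : r.Surjective := by
      intro e
      have h1 : (r e).fst = e.fst := ((hcyc e (r e)).1 ⟨1, by omega, (hr e).symm⟩).symm
      obtain ⟨t, -, ht⟩ := (hcyc (r e) e).2 h1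
      rw [hit] at ht
      exact ⟨r^[t] e, by
        rw [← Function.iterate_succ_apply' r, Function.iterate_succ_apply, h.dartCode_injective ht]⟩
    have : Finite G.Dart := Finite.of_injective
      (fun d => (⟨h.dartCode d, h.dartCode_lt d⟩ : Fin (n ^ 2)))
      fun _ _ hde => h.dartCode_injective (congrArg Fin.val hde)
    let rot := Equiv.ofBijective r (Finite.surjective_iff_bijective.1 hsurj)
    exact ⟨rot, (key rot R fun d => (hr d).symm).1 hR⟩

end IsNatCopy

/-! ### Primitive recursive predicates -/

section PrimitiveRecursive

open Primrec

variable {α β γ : Type*} [Primcodable α] [Primcodable β]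

theorem PrimrecPred.imp {p q : α → Prop} (hp : PrimrecPred p) (hq : PrimrecPred q) :
    PrimrecPred fun a => p a → q a := by
  classical exact (hp.not.or hq).of_eq fun a => by tauto

theorem PrimrecPred.iff {p q : α → Prop} (hp : PrimrecPred p) (hq : PrimrecPred q) :
    PrimrecPred fun a => p a ↔ q a :=
  ((hp.imp hq).and (hq.imp hp)).of_eq fun _ => iff_def.symm

theorem PrimrecPred.exists_lt_bound {p : α → ℕ → Prop} {b : α → ℕ} (hb : Primrec b)
    (hp : PrimrecPred fun x : α × ℕ => p x.1 x.2) : PrimrecPred fun a => ∃ x < b a, p a x := by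
  have hp' : PrimrecRel fun (x : ℕ) (a : α) => p a x := PrimrecRel.swap hp
  refine (hp'.exists_mem_list.comp (list_range.comp hb) Primrec.id).of_eq fun a => ?_
  simp

theorem PrimrecPred.forall_lt_bound {p : α → ℕ → Prop} {b : α → ℕ} (hb : Primrec b)
    (hp : PrimrecPred fun x : α × ℕ => p x.1 x.2) : PrimrecPred fun a => ∀ x < b a, p a x := by
  have hp' : PrimrecRel fun (x : ℕ) (a : α) => p a x := PrimrecRel.swap hp
  refine (hp'.forall_mem_list.comp (list_range.comp hb) Primrec.id).of_eq fun a => ?_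
  simp

theorem Primrec.nat_pow : Primrec₂ ((· ^ ·) : ℕ → ℕ → ℕ) :=
  Primrec₂.unpaired'.1 Nat.Primrec.pow

theorem primrec_natDigit {b R i : α → ℕ} (hb : Primrec b) (hR : Primrec R) (hi : Primrec i) :
    Primrec fun x => natDigit (b x) (R x) (i x) :=
  nat_mod.comp (nat_div.comp hR (nat_pow.comp hb hi)) hb

theorem primrecRel_natDigit_two : PrimrecRel fun R i => natDigit 2 R i = 1 :=
  Primrec.eq.comp (primrec_natDigit (const 2) fst snd) (const 1)

theorem primrec_natCount {p : α → ℕ → Prop} (hp : PrimrecRel p) {b : α → ℕ} (hb : Primrec b) :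
    Primrec fun a => natCount (b a) (p a) := by
  classical
  have hp' : PrimrecRel fun (x : ℕ) (a : α) => p a x := PrimrecRel.swap hp
  refine (list_length.comp (hp'.listFilter.comp (list_range.comp hb) Primrec.id)).of_eq fun a => ?_
  rw [natCount, Nat.subtype_card ((Finset.range (b a)).filter (p a)) (by simp)]
  rfl

section Graphs

variable {n : α → ℕ} {s : α → ℕ → Prop} {a : α → ℕ → ℕ → Prop}

theorem primrecPred_natTriangleFree (hn : Primrec n)
    (ha : PrimrecPred fun x : (α × ℕ) × ℕ => a x.1.1 x.1.2 x.2) :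
    PrimrecPred fun x => NatTriangleFree (n x) (a x) := by
  refine .forall_lt_bound hn ?_
  refine .forall_lt_bound (hn.comp fst) ?_
  refine .forall_lt_bound (hn.comp (fst.comp fst)) ?_
  refine .not (.and ?_ (.and ?_ ?_))
  · exact ha.comp fst
  · exact ha.comp ((fst.comp fst).pair snd)
  · exact ha.comp (((fst.comp (fst.comp fst)).pair (snd.comp fst)).pair snd)

theorem primrecPred_natBipartite (hn : Primrec n)
    (ha : PrimrecPred fun x : (α × ℕ) × ℕ => a x.1.1 x.1.2 x.2) :
    PrimrecPred fun x => NatBipartite (n x) (a x) := by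
  refine .exists_lt_bound (nat_pow.comp (const 2) hn) ?_
  refine .forall_lt_bound (hn.comp fst) ?_
  refine .forall_lt_bound (hn.comp (fst.comp fst)) ?_
  refine .imp ?_ (.not ?_)
  · exact ha.comp (((fst.comp (fst.comp fst)).pair (snd.comp fst)).pair snd)
  · exact Primrec.eq.comp (primrec_natDigit (const 2) (snd.comp (fst.comp fst)) (snd.comp fst))
      (primrec_natDigit (const 2) (snd.comp (fst.comp fst)) snd)

theorem primrec_natRot {n R d : α → ℕ} (hn : Primrec n) (hR : Primrec R) (hd : Primrec d) :
    Primrec fun x => natRot (n x) (R x) (d x) :=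
  primrec_natDigit (nat_pow.comp hn (const 2)) hR hd

theorem primrec_natFace {n R d : α → ℕ} (hn : Primrec n) (hR : Primrec R) (hd : Primrec d) :
    Primrec fun x => natFace (n x) (R x) (d x) :=
  primrec_natRot hn hR (nat_add.comp (nat_mul.comp (nat_mod.comp hd hn) hn) (nat_div.comp hd hn))

theorem primrecRel_natIsDart (hn : Primrec n)
    (ha : PrimrecPred fun x : (α × ℕ) × ℕ => a x.1.1 x.1.2 x.2) :
    PrimrecRel fun x => NatIsDart (n x) (a x) :=
  ha.comp ((fst.pair (nat_div.comp snd (hn.comp fst))).pair (nat_mod.comp snd (hn.comp fst)))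

theorem primrecRel_minimal_face {R : α → ℕ} (hn : Primrec n) (hR : Primrec R)
    (ha : PrimrecPred fun x : (α × ℕ) × ℕ => a x.1.1 x.1.2 x.2) :
    PrimrecRel fun x d => NatIsDart (n x) (a x) d ∧
      ∀ t < n x ^ 2 + 2, d ≤ (natFace (n x) (R x))^[t] d := by
  refine .and (primrecRel_natIsDart hn ha) ?_
  refine .forall_lt_bound (nat_add.comp (nat_pow.comp (hn.comp fst) (const 2)) (const 2)) ?_
  refine nat_le.comp (snd.comp fst) (nat_iterate snd (snd.comp fst) ?_)
  have h : Primrec fun q : ((α × ℕ) × ℕ) × ℕ => q.1.1.1 := fst.comp (fst.comp fst)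
  exact primrec_natFace (hn.comp h) (hR.comp h) snd

theorem primrecRel_isolated (hn : Primrec n) (hs : PrimrecRel s)
    (ha : PrimrecPred fun x : (α × ℕ) × ℕ => a x.1.1 x.1.2 x.2) :
    PrimrecRel fun x v => s x v ∧ ∀ w < n x, ¬ a x v w :=
  PrimrecPred.and hs (.forall_lt_bound (hn.comp fst) (.not ha))

theorem primrecRel_minimal_component (hn : Primrec n) (hs : PrimrecRel s)
    (ha : PrimrecPred fun x : (α × ℕ) × ℕ => a x.1.1 x.1.2 x.2) :
    PrimrecRel fun x v => s x v ∧ ∀ u < v, ∃ T < 2 ^ n x,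
      natDigit 2 T v = 1 ∧ ¬ natDigit 2 T u = 1 ∧
        ∀ i < n x, ∀ j < n x, natDigit 2 T i = 1 → a x i j → natDigit 2 T j = 1 := by
  refine .and hs ?_
  refine .forall_lt_bound snd ?_
  refine .exists_lt_bound (nat_pow.comp (const 2) (hn.comp (fst.comp fst))) ?_
  refine .and ?_ (.and (.not ?_) ?_)
  · exact primrecRel_natDigit_two.comp snd (snd.comp (fst.comp fst))
  · exact primrecRel_natDigit_two.comp snd (snd.comp fst)
  refine .forall_lt_bound (hn.comp (fst.comp (fst.comp fst))) ?_
  refine .forall_lt_bound (hn.comp (fst.comp (fst.comp (fst.comp fst)))) ?_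
  refine .imp ?_ (.imp ?_ ?_)
  · exact primrecRel_natDigit_two.comp (snd.comp (fst.comp fst)) (snd.comp fst)
  · exact ha.comp (((fst.comp (fst.comp (fst.comp (fst.comp fst)))).pair (snd.comp fst)).pair snd)
  · exact primrecRel_natDigit_two.comp (snd.comp (fst.comp fst)) snd

theorem primrecPred_natSpherical {R : α → ℕ} (hn : Primrec n) (hR : Primrec R) (hs : PrimrecRel s)
    (ha : PrimrecPred fun x : (α × ℕ) × ℕ => a x.1.1 x.1.2 x.2) :
    PrimrecPred fun x => NatSpherical (n x) (s x) (a x) (R x) := by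
  have hn2 : Primrec fun x => n x ^ 2 := nat_pow.comp hn (const 2)
  have hd := primrecRel_natIsDart hn ha
  refine .and (.forall_lt_bound hn2 (.imp hd ?_)) (.and (.forall_lt_bound hn2 ?_) ?_)
  · exact hd.comp fst (primrec_natRot (hn.comp fst) (hR.comp fst) snd)
  · refine .forall_lt_bound (hn2.comp fst) ?_
    refine .imp (hd.comp (fst.comp fst) (snd.comp fst)) (.imp (hd.comp (fst.comp fst) snd)
      (.iff ?_ ?_))
    · refine .exists_lt_bound (nat_add.comp (hn2.comp (fst.comp fst)) (const 2)) ?_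
      refine Primrec.eq.comp (nat_iterate snd (snd.comp (fst.comp fst)) ?_) (snd.comp fst)
      have h : Primrec fun q : (((α × ℕ) × ℕ) × ℕ) × ℕ => q.1.1.1.1 :=
        fst.comp (fst.comp (fst.comp fst))
      exact primrec_natRot (hn.comp h) (hR.comp h) snd
    · exact Primrec.eq.comp (nat_div.comp (snd.comp fst) (hn.comp (fst.comp fst)))
        (nat_div.comp snd (hn.comp (fst.comp fst)))
  refine Primrec.eq.comp ?_ ?_
  · exact nat_mul.comp (const 2) (nat_add.comp (primrec_natCount hs hn) (nat_add.comp
      (primrec_natCount (primrecRel_minimal_face hn hR ha) hn2)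
      (primrec_natCount (primrecRel_isolated hn hs ha) hn)))
  · exact nat_add.comp (primrec_natCount hd hn2) (nat_mul.comp (const 4)
      (primrec_natCount (primrecRel_minimal_component hn hs ha) hn))

theorem primrecPred_natPlanar (hn : Primrec n) (hs : PrimrecRel s)
    (ha : PrimrecPred fun x : (α × ℕ) × ℕ => a x.1.1 x.1.2 x.2) :
    PrimrecPred fun x => NatPlanar (n x) (s x) (a x) := by
  have hn2 : Primrec fun x => n x ^ 2 := nat_pow.comp hn (const 2)
  refine .exists_lt_bound (nat_pow.comp hn2 hn2) ?_
  exact primrecPred_natSpherical (s := fun x : α × ℕ => s x.1) (a := fun x : α × ℕ => a x.1)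
    (hn.comp fst) snd (hs.comp (fst.comp fst) snd)
    (ha.comp (((fst.comp (fst.comp fst)).pair (snd.comp fst)).pair snd))

end Graphs

end PrimitiveRecursive

/-! ### Deciding instances that are given as numbers -/

/-- The number whose binary digits, least significant first, are `s` followed by a final one. -/
def bitsToPosNum : List Bool → PosNum
  | [] => 1
  | false :: s => (bitsToPosNum s).bit0
  | true :: s => (bitsToPosNum s).bit1

/-- The number whose binary digits, least significant first, are `s` followed by a final one. -/
def bitsToNat (s : List Bool) : ℕ := bitsToPosNum s

@[simp]
theorem bitsToNat_nil : bitsToNat [] = 1 := rfl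

@[simp]
theorem bitsToNat_cons (b : Bool) (s : List Bool) :
    bitsToNat (b :: s) = b.toNat + 2 * bitsToNat s := by
  cases b
  · simp [bitsToNat, bitsToPosNum, two_mul]
  · simp only [bitsToNat, bitsToPosNum, PosNum.cast_bit1, Bool.toNat_true]
    omega

theorem natDigit_bitsToNat (s : List Bool) (i : ℕ) (hi : i < s.length) :
    natDigit 2 (bitsToNat s) i = s[i].toNat := by
  induction s generalizing i with
  | nil => simp at hi
  | cons b s ih =>
    have hb := b.toNat_lt
    cases i with
    | zero =>
      simp only [natDigit, bitsToNat_cons, pow_zero, Nat.div_one, List.getElem_cons_zero]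
      omega
    | succ i =>
      rw [List.getElem_cons_succ, ← ih i (by simpa using hi), natDigit, natDigit, bitsToNat_cons,
        pow_succ', ← Nat.div_div_eq_div_mul,
        show (b.toNat + 2 * bitsToNat s) / 2 = bitsToNat s by omega]

theorem bitsToNat_append_div (s t : List Bool) :
    bitsToNat (s ++ t) / 2 ^ s.length = bitsToNat t := by
  induction s with
  | nil => simp
  | cons b s ih =>
    have : (b.toNat + 2 * bitsToNat (s ++ t)) / 2 = bitsToNat (s ++ t) := by
      have := b.toNat_lt
      omega
    rw [List.cons_append, bitsToNat_cons, List.length_cons, pow_succ', ← Nat.div_div_eq_div_mul,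
      this, ih]

theorem two_pow_length_le_bitsToNat (s : List Bool) : 2 ^ s.length ≤ bitsToNat s := by
  induction s with
  | nil => simp
  | cons b s ih =>
    rw [List.length_cons, pow_succ, bitsToNat_cons]
    omega

/-- The terminal one of `bitsToNat` adds the power of two just beyond the digits of `p`. Together
with the bound below, this makes both the value and the number of digits recoverable. -/
theorem bitsToNat_encodePosNum (p : PosNum) :
    bitsToNat (Computability.encodePosNum p) = p + 2 ^ (Computability.encodePosNum p).length := by
  induction p with
  | one => rfl
  | bit0 p ih =>
    rw [Computability.encodePosNum, bitsToNat_cons, ih, PosNum.cast_bit0, List.length_cons]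
    simp; ring
  | bit1 p ih =>
    rw [Computability.encodePosNum, bitsToNat_cons, ih, PosNum.cast_bit1, List.length_cons]
    simp; ring

theorem lt_two_pow_length_encodePosNum (p : PosNum) :
    (p : ℕ) < 2 ^ (Computability.encodePosNum p).length := by
  induction p with
  | one => simp [Computability.encodePosNum]
  | bit0 p ih =>
    rw [Computability.encodePosNum, PosNum.cast_bit0, List.length_cons, pow_succ]
    omega
  | bit1 p ih =>
    rw [Computability.encodePosNum, PosNum.cast_bit1, List.length_cons, pow_succ]
    omega

theorem length_encodePosNum_le (p : PosNum) : (Computability.encodePosNum p).length ≤ p := by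
  induction p with
  | one => simp [Computability.encodePosNum]
  | bit0 p ih =>
    have := PosNum.cast_pos (α := ℕ) p
    rw [Computability.encodePosNum, PosNum.cast_bit0, List.length_cons]
    omega
  | bit1 p ih =>
    have := PosNum.cast_pos (α := ℕ) p
    rw [Computability.encodePosNum, PosNum.cast_bit1, List.length_cons]
    omega

theorem encodeNat_cases (k : ℕ) : (k = 0 ∧ Computability.encodeNat k = []) ∨
    ∃ p : PosNum, k = p ∧ Computability.encodeNat k = Computability.encodePosNum p := by
  rw [Computability.encodeNat]
  have h := Num.to_of_nat k
  cases hk : (k : Num) with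
  | zero =>
    rw [hk] at h
    exact .inl ⟨h.symm, rfl⟩
  | pos p =>
    rw [hk] at h
    exact .inr ⟨p, h.symm, rfl⟩

theorem bitsToNat_encodeNat (k : ℕ) :
    bitsToNat (Computability.encodeNat k) = k + 2 ^ (Computability.encodeNat k).length := by
  obtain ⟨rfl, h⟩ | ⟨p, rfl, h⟩ := encodeNat_cases k <;> rw [h]
  · rfl
  · exact bitsToNat_encodePosNum p

theorem lt_two_pow_length_encodeNat (k : ℕ) : k < 2 ^ (Computability.encodeNat k).length := by
  obtain ⟨rfl, h⟩ | ⟨p, rfl, h⟩ := encodeNat_cases k <;> rw [h]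
  · simp
  · exact lt_two_pow_length_encodePosNum p

theorem length_encodeNat_le (k : ℕ) : (Computability.encodeNat k).length ≤ k := by
  obtain ⟨rfl, h⟩ | ⟨p, rfl, h⟩ := encodeNat_cases k <;> rw [h]
  · simp
  · exact length_encodePosNum_le p

theorem natDigit_bitsToNat_append (s t : List Bool) (i : ℕ) :
    natDigit 2 (bitsToNat (s ++ t)) (s.length + i) = natDigit 2 (bitsToNat t) i := by
  rw [natDigit, natDigit, pow_add, ← Nat.div_div_eq_div_mul, bitsToNat_append_div]

theorem adjacencyBits_eq_ofFn {n : ℕ} (G : SimpleGraph (Fin n)) [DecidableRel G.Adj] :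
    adjacencyBits G = List.ofFn fun x : Fin (n * n) => decide (G.Adj x.divNat x.modNat) := by
  rw [List.ofFn_mul, adjacencyBits, List.flatMap_def, List.ofFn_eq_map]
  congr 1
  refine List.map_congr_left fun i _ => ?_
  rw [List.ofFn_eq_map]
  refine List.map_congr_left fun j _ => ?_
  have h : (⟨i * n + j, by nlinarith [i.2, j.2]⟩ : Fin (n * n)) = finProdFinEquiv (i, j) :=
    Fin.ext (by simp; ring)
  have h2 := finProdFinEquiv.symm_apply_apply (i, j)
  rw [← h] at h2
  have h3 := congrArg Prod.fst h2
  have h4 := congrArg Prod.snd h2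
  simp only [finProdFinEquiv_symm_apply] at h3 h4
  rw [h3, h4]
  congr

@[simp]
theorem length_adjacencyBits {n : ℕ} (G : SimpleGraph (Fin n)) :
    (adjacencyBits G).length = n * n := by
  classical
  rw [adjacencyBits_eq_ofFn, List.length_ofFn]

theorem natDigit_adjacencyBits_append {n : ℕ} (G : SimpleGraph (Fin n)) (t : List Bool)
    (i j : Fin n) :
    natDigit 2 (bitsToNat (adjacencyBits G ++ t)) (i * n + j) = 1 ↔ G.Adj i j := by
  classical
  have hlt : (i : ℕ) * n + j < n * n := by nlinarith [i.2, j.2]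
  rw [natDigit_bitsToNat _ _ (by simp; omega), List.getElem_append_left (by simpa using hlt)]
  simp only [adjacencyBits_eq_ofFn, List.getElem_ofFn, Bool.toNat_eq_one, decide_eq_true_eq]
  have h1 : Fin.divNat (⟨i * n + j, hlt⟩ : Fin (n * n)) = i := Fin.ext (by
    simp only [Fin.coe_divNat]
    rw [mul_comm, Nat.mul_add_div (by omega), Nat.div_eq_of_lt j.2, add_zero])
  have h2 : Fin.modNat (⟨i * n + j, hlt⟩ : Fin (n * n)) = j := Fin.ext (by
    simp only [Fin.coe_modNat]
    rw [mul_comm, Nat.mul_add_mod, Nat.mod_eq_of_lt j.2])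
  rw [h1, h2]

/-- The adjacency matrix that is encoded in `N`, restricted to the vertex set encoded in `T`. -/
def NatAdj (N n T i j : ℕ) : Prop :=
  natDigit 2 T i = 1 ∧ natDigit 2 T j = 1 ∧ natDigit 2 N (n + 1 + (i * n + j)) = 1

/-- The number `N` encodes a graph on `n` vertices and a number `k`, and `k` of the vertices induce
a subgraph with the property `Q`. -/
def NatYes (Q : ℕ → (ℕ → Prop) → (ℕ → ℕ → Prop) → Prop) (N : ℕ) : Prop :=
  ∃ n < N + 1, ∃ k < N + 1, ∃ l < N + 1, ∃ T < 2 ^ n,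
    (∀ i < n, natDigit 2 N i = 1) ∧ ¬ natDigit 2 N n = 1 ∧
    N / 2 ^ (n + 1 + n * n) = k + 2 ^ l ∧ k < 2 ^ l ∧
    natCount n (fun i => natDigit 2 T i = 1) = k ∧
    Q n (fun i => natDigit 2 T i = 1) (NatAdj N n T)

section NatYes

open Primrec

theorem primrecPred_natYes {Q : ℕ → (ℕ → Prop) → (ℕ → ℕ → Prop) → Prop}
    (hQ : ∀ {α : Type} [Primcodable α] {n : α → ℕ} {s : α → ℕ → Prop} {a : α → ℕ → ℕ → Prop},
      Primrec n → PrimrecRel s → (PrimrecPred fun x : (α × ℕ) × ℕ => a x.1.1 x.1.2 x.2) →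
      PrimrecPred fun x => Q (n x) (s x) (a x)) :
    PrimrecPred (NatYes Q) := by
  have hN : Primrec fun x : (((ℕ × ℕ) × ℕ) × ℕ) × ℕ => x.1.1.1.1 :=
    fst.comp (fst.comp (fst.comp fst))
  have hn : Primrec fun x : (((ℕ × ℕ) × ℕ) × ℕ) × ℕ => x.1.1.1.2 :=
    snd.comp (fst.comp (fst.comp fst))
  have hk : Primrec fun x : (((ℕ × ℕ) × ℕ) × ℕ) × ℕ => x.1.1.2 := snd.comp (fst.comp fst)
  have hl : Primrec fun x : (((ℕ × ℕ) × ℕ) × ℕ) × ℕ => x.1.2 := snd.comp fst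
  have hT : Primrec fun x : (((ℕ × ℕ) × ℕ) × ℕ) × ℕ => x.2 := snd
  have hTs : PrimrecRel fun (x : (((ℕ × ℕ) × ℕ) × ℕ) × ℕ) i => natDigit 2 x.2 i = 1 :=
    primrecRel_natDigit_two.comp (snd.comp fst) snd
  refine .exists_lt_bound succ ?_
  refine .exists_lt_bound (succ.comp fst) ?_
  refine .exists_lt_bound (succ.comp (fst.comp fst)) ?_
  refine .exists_lt_bound (nat_pow.comp (const 2) (snd.comp (fst.comp fst))) ?_
  refine .and ?_ (.and (.not ?_) (.and ?_ (.and ?_ (.and ?_ ?_))))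
  · exact .forall_lt_bound hn (primrecRel_natDigit_two.comp (hN.comp fst) snd)
  · exact primrecRel_natDigit_two.comp hN hn
  · exact Primrec.eq.comp (nat_div.comp hN (nat_pow.comp (const 2)
      (nat_add.comp (nat_add.comp hn (const 1)) (nat_mul.comp hn hn))))
      (nat_add.comp hk (nat_pow.comp (const 2) hl))
  · exact nat_lt.comp hk (nat_pow.comp (const 2) hl)
  · exact Primrec.eq.comp (primrec_natCount hTs hn) hk
  · refine hQ hn hTs ?_
    have hi : Primrec fun x : ((((((ℕ × ℕ) × ℕ) × ℕ) × ℕ) × ℕ) × ℕ) => x.1.2 := snd.comp fst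
    have h : Primrec fun x : ((((((ℕ × ℕ) × ℕ) × ℕ) × ℕ) × ℕ) × ℕ) => x.1.1 := fst.comp fst
    refine .and ?_ (.and ?_ ?_)
    · exact primrecRel_natDigit_two.comp (hT.comp h) hi
    · exact primrecRel_natDigit_two.comp (hT.comp h) snd
    · exact primrecRel_natDigit_two.comp (hN.comp h) (nat_add.comp
        (nat_add.comp (hn.comp h) (const 1)) (nat_add.comp (nat_mul.comp hi (hn.comp h)) snd))

end NatYes

/-! ### Recovering an instance from the number that encodes it. -/

namespace InducedSubgraphInstance

variable {PG : GraphProperty} (I : InducedSubgraphInstance PG)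

theorem length_encode :
    I.encode.length = I.n + 1 + I.n * I.n + (Computability.encodeNat I.k).length := by
  simp [encode]
  omega

theorem natDigit_encode_of_lt {i : ℕ} (hi : i < I.n) : natDigit 2 (bitsToNat I.encode) i = 1 := by
  rw [natDigit_bitsToNat _ _ (by rw [length_encode]; omega)]
  simp [encode, hi]

theorem natDigit_encode_self : ¬ natDigit 2 (bitsToNat I.encode) I.n = 1 := by
  rw [natDigit_bitsToNat _ _ (by rw [length_encode]; omega)]
  simp [encode]

theorem natDigit_encode_adj (i j : Fin I.n) :
    natDigit 2 (bitsToNat I.encode) (I.n + 1 + (i * I.n + j)) = 1 ↔ I.G.Adj i j := by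
  rw [encode, List.append_assoc]
  have := natDigit_bitsToNat_append (List.replicate I.n true ++ [false])
    (adjacencyBits I.G ++ Computability.encodeNat I.k) (i * I.n + j)
  rw [List.length_append, List.length_replicate, List.length_singleton] at this
  rw [this, natDigit_adjacencyBits_append]

theorem bitsToNat_encode_div : bitsToNat I.encode / 2 ^ (I.n + 1 + I.n * I.n) =
    I.k + 2 ^ (Computability.encodeNat I.k).length := by
  have := bitsToNat_append_div (List.replicate I.n true ++ [false] ++ adjacencyBits I.G)
    (Computability.encodeNat I.k)
  rw [List.length_append, List.length_append, List.length_replicate, List.length_singleton,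
    length_adjacencyBits] at this
  rw [encode, this, bitsToNat_encodeNat]

theorem isNatCopy_induce (S : Finset (Fin I.n)) {T : ℕ}
    (hT : ∀ i : Fin I.n, natDigit 2 T i = 1 ↔ i ∈ S) :
    IsNatCopy (V := {v : Fin I.n // v ∈ S}) (I.G.induce {v | v ∈ S}) I.n
      (fun i => natDigit 2 T i = 1) (NatAdj (bitsToNat I.encode) I.n T) fun v => v.1 where
  inj v w h := Subtype.ext (Fin.ext h)
  lt v := v.1.2
  mem v := (hT _).2 v.2
  surj i hi hs := ⟨⟨⟨i, hi⟩, (hT ⟨i, hi⟩).1 hs⟩, rfl⟩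
  adj u v := by
    rw [NatAdj, I.natDigit_encode_adj, hT, hT]
    exact ⟨fun h => h.2.2, fun h => ⟨u.2, v.2, h⟩⟩
  left i j h := h.1
  right i j h := h.2.1

theorem natYes_encode_iff {P : GraphProperty} {Q : ℕ → (ℕ → Prop) → (ℕ → ℕ → Prop) → Prop}
    (hQ : ∀ {V : Type} {G : SimpleGraph V} {n : ℕ} {s : ℕ → Prop} {a : ℕ → ℕ → Prop} {f : V → ℕ},
      IsNatCopy G n s a f → ∀ [Finite V], P V G ↔ Q n s a) :
    NatYes Q (bitsToNat I.encode) ↔ (inducedSubgraphProblem PG P).IsYes I := by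
  constructor
  · rintro ⟨n, -, k, -, l, -, T, -, h1, h2, h3, h4, h5, h6⟩
    -- The number of vertices is the position of the first zero digit.
    obtain rfl : n = I.n := by
      rcases lt_trichotomy n I.n with h | h | h
      · exact absurd (I.natDigit_encode_of_lt h) h2
      · exact h
      · exact absurd (h1 _ h) I.natDigit_encode_self
    rw [bitsToNat_encode_div] at h3
    have hk := lt_two_pow_length_encodeNat I.k
    -- From `k < 2 ^ l` it follows that `k + 2 ^ l` lies between `2 ^ l` and `2 ^ (l + 1)`, so `l`,
    -- and with it `k`, is determined.
    obtain rfl : l = (Computability.encodeNat I.k).length := by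
      rcases lt_trichotomy l (Computability.encodeNat I.k).length with h | h | h
      · have := Nat.pow_le_pow_right two_pos (Nat.succ_le_of_lt h)
        rw [pow_succ] at this
        omega
      · exact h
      · have := Nat.pow_le_pow_right two_pos (Nat.succ_le_of_lt h)
        rw [pow_succ] at this
        omega
    have hT : ∀ i : Fin I.n, natDigit 2 T i = 1 ↔
        i ∈ Finset.univ.filter fun i : Fin I.n => natDigit 2 T i = 1 := by simp
    have hcopy := I.isNatCopy_induce _ hT
    refine ⟨_, ?_, (hQ hcopy).2 h6⟩
    have := hcopy.natCount_vertices
    rw [Nat.subtype_card _ fun _ => Iff.rfl] at this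
    omega
  · rintro ⟨S, hS, hP⟩
    obtain ⟨T, hT2, hT⟩ := exists_natDigit_two_iff (m := I.n) fun i => ∃ v ∈ S, (v : ℕ) = i
    have hT' : ∀ i : Fin I.n, natDigit 2 T i = 1 ↔ i ∈ S := fun i => by
      rw [hT i i.2]
      exact ⟨fun ⟨v, hv, hvi⟩ => Fin.ext hvi ▸ hv, fun h => ⟨i, h, rfl⟩⟩
    have hcopy := I.isNatCopy_induce _ hT'
    have hlen := I.length_encode
    have h1 := Nat.lt_two_pow_self (n := I.encode.length)
    have h2 := two_pow_length_le_bitsToNat I.encode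
    have h3 := lt_two_pow_length_encodeNat I.k
    have h4 := Nat.pow_le_pow_right two_pos
      (show (Computability.encodeNat I.k).length ≤ I.encode.length by omega)
    refine ⟨I.n, by omega, I.k, by omega, _, by omega, T, hT2, fun i => I.natDigit_encode_of_lt,
      I.natDigit_encode_self, I.bitsToNat_encode_div, h3, ?_, (hQ hcopy).1 hP⟩
    rw [hcopy.natCount_vertices, Nat.subtype_card _ fun _ => Iff.rfl, hS]

end InducedSubgraphInstance

/-- On its instances the problem agrees with a primitive recursive predicate of their encodings. -/
theorem exists_primrecPred_isYes (PG : GraphProperty) {P : GraphProperty}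
    (hP : P = GraphProperty.planar ∨ P = GraphProperty.bipartite ∨
      P = GraphProperty.triangleFree) :
    ∃ Y : ℕ → Prop, PrimrecPred Y ∧ ∀ I : InducedSubgraphInstance PG,
      Y (bitsToNat I.encode) ↔ (inducedSubgraphProblem PG P).IsYes I := by
  rcases hP with rfl | rfl | rfl
  · exact ⟨NatYes NatPlanar, primrecPred_natYes primrecPred_natPlanar,
      fun I => I.natYes_encode_iff fun h => h.planar_iff⟩
  · exact ⟨NatYes fun n _ a => NatBipartite n a,
      primrecPred_natYes fun hn _ ha => primrecPred_natBipartite hn ha,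
      fun I => I.natYes_encode_iff fun h => h.bipartite_iff⟩
  · exact ⟨NatYes fun n _ a => NatTriangleFree n a,
      primrecPred_natYes fun hn _ ha => primrecPred_natTriangleFree hn ha,
      fun I => I.natYes_encode_iff fun h => h.triangleFree_iff⟩

/-! ### Running times of the machines that evaluate partial recursive functions -/

/-- A finite case distinction on the first argument. It is applied to the finitely many labels that
a compiled machine can reach. -/
theorem Primrec.of_finite_fst {α β γ : Type*} [Primcodable α] [Primcodable β] [Primcodable γ]
    [Finite α] {f : α → β → γ} (hf : ∀ a, Primrec (f a)) : Primrec₂ f := by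
  classical
  have := Fintype.ofFinite α
  rcases isEmpty_or_nonempty γ with hγ | ⟨⟨c⟩⟩
  · have : IsEmpty (α × β) := ⟨fun x => hγ.false (f x.1 x.2)⟩
    exact Primrec.encode_iff.1 ((Primrec.const 0).of_eq fun x : α × β => isEmptyElim x)
  have key : ∀ s : Finset α, Primrec fun x : α × β => if x.1 ∈ s then f x.1 x.2 else c := by
    intro s
    induction s using Finset.induction_on with
    | empty => simpa using Primrec.const c
    | insert a s _ ih =>
      refine (Primrec.ite (Primrec.eq.comp Primrec.fst (Primrec.const a))
        ((hf a).comp Primrec.snd) ih).of_eq fun x => ?_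
      by_cases h : x.1 = a
      · simp [h]
      · simp [h]
  exact (key Finset.univ).of_eq fun x => by simp

theorem Computable.of_find {α : Type*} [Primcodable α] {p : α → ℕ → Prop}
    (hp : PrimrecPred fun x : α × ℕ => p x.1 x.2) {g : α → ℕ} (hg : ∀ a, p a (g a))
    (hmin : ∀ a, ∀ t < g a, ¬ p a t) : Computable g := by
  classical
  have h1 : Computable₂ fun a t => decide (p a t) := (PrimrecPred.decide hp).to_comp
  refine (Partrec.rfind h1.partrec₂).of_eq fun a => ?_
  refine Part.eq_some_iff.2 (Nat.mem_rfind.2 ⟨?_, fun ht => ?_⟩)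
  · simpa using hg a
  · simpa using hmin a _ ht

namespace Turing.PartrecToTM2

open ToPartrec TM2.Stmt

noncomputable instance : Primcodable Γ' := Primcodable.ofEquiv _ (Fintype.equivFin Γ')

noncomputable instance (S : Finset Λ') : Primcodable S := Primcodable.ofEquiv _ S.equivFin

instance : Fintype K' :=
  ⟨{.main, .rev, .aux, .stack}, by rintro (_ | _ | _ | _) <;> simp⟩

/-- A configuration with labels in the finite set `S`, as a tuple. -/
abbrev Tuple (S : Finset Λ') : Type :=
  Option S × Option Γ' × List Γ' × List Γ' × List Γ' × List Γ'

open Classical in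
/-- The label as an element of the finite set `S`. -/
noncomputable def restrictLabel (S : Finset Λ') (l : Λ') : Option S :=
  if h : l ∈ S then some ⟨l, h⟩ else none

/-- A configuration as a tuple. -/
noncomputable def toTuple (S : Finset Λ') (c : Cfg') : Tuple S :=
  (c.l.bind (restrictLabel S), c.var, c.stk .main, c.stk .rev, c.stk .aux, c.stk .stack)

/-- Labels outside `S` are also sent to `none`, so tuples detect halting only for configurations
whose label stays in `S`. -/
theorem toTuple_fst_eq_none_iff {S : Finset Λ'} {c : Cfg'} (hc : c.l ∈ Finset.insertNone S) :
    (toTuple S c).1 = none ↔ c.l = none := by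
  rw [Finset.mem_insertNone] at hc
  cases h : c.l with
  | none => simp [toTuple, h]
  | some l => simp [toTuple, h, restrictLabel, hc l h]

/-- One step on tuples; halting configurations are fixed. -/
noncomputable def stepTuple (S : Finset Λ') (x : Tuple S) : Tuple S :=
  match x.1 with
  | none => x
  | some l => toTuple S (TM2.stepAux (tr l) x.2.1
      (K'.elim x.2.2.1 x.2.2.2.1 x.2.2.2.2.1 x.2.2.2.2.2))

/-- Every statement is a finite composition of list operations on the four stacks and functions with
finite domain, all of which are primitive recursive. -/
theorem primrec_toTuple_stepAux {α : Type*} [Primcodable α] (S : Finset Λ')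
    (q : TM2.Stmt (fun _ : K' => Γ') Λ' (Option Γ')) {v : α → Option Γ'}
    {a b c d : α → List Γ'} (hv : Primrec v) (ha : Primrec a) (hb : Primrec b) (hc : Primrec c)
    (hd : Primrec d) :
    Primrec fun x => toTuple S (TM2.stepAux q (v x) (K'.elim (a x) (b x) (c x) (d x))) := by
  have happ : ∀ (f : Option Γ' → Option Γ' → Option Γ') {v w : α → Option Γ'},
      Primrec v → Primrec w → Primrec fun x => f (v x) (w x) := fun f _ _ hv hw =>
    (Primrec.dom_finite fun p : Option Γ' × Option Γ' => f p.1 p.2).comp (hv.pair hw)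
  induction q generalizing v a b c d with
  | push k f q ih =>
    have hf : Primrec fun x => f (v x) := (Primrec.dom_finite f).comp hv
    cases k
    · simpa using ih hv (Primrec.list_cons.comp hf ha) hb hc hd
    · simpa using ih hv ha (Primrec.list_cons.comp hf hb) hc hd
    · simpa using ih hv ha hb (Primrec.list_cons.comp hf hc) hd
    · simpa using ih hv ha hb hc (Primrec.list_cons.comp hf hd)
  | peek k f q ih =>
    cases k
    · exact ih (happ f hv (Primrec.list_head?.comp ha)) ha hb hc hd
    · exact ih (happ f hv (Primrec.list_head?.comp hb)) ha hb hc hd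
    · exact ih (happ f hv (Primrec.list_head?.comp hc)) ha hb hc hd
    · exact ih (happ f hv (Primrec.list_head?.comp hd)) ha hb hc hd
  | pop k f q ih =>
    cases k
    · simpa using ih (happ f hv (Primrec.list_head?.comp ha)) (Primrec.list_tail.comp ha) hb hc hd
    · simpa using ih (happ f hv (Primrec.list_head?.comp hb)) ha (Primrec.list_tail.comp hb) hc hd
    · simpa using ih (happ f hv (Primrec.list_head?.comp hc)) ha hb (Primrec.list_tail.comp hc) hd
    · simpa using ih (happ f hv (Primrec.list_head?.comp hd)) ha hb hc (Primrec.list_tail.comp hd)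
  | load f q ih => exact ih ((Primrec.dom_finite f).comp hv) ha hb hc hd
  | branch f q₁ q₂ ih₁ ih₂ =>
    refine (Primrec.cond ((Primrec.dom_finite f).comp hv) (ih₁ hv ha hb hc hd)
      (ih₂ hv ha hb hc hd)).of_eq fun x => ?_
    cases h : f (v x) <;> simp [h]
  | goto f =>
    exact ((Primrec.dom_finite fun v => restrictLabel S (f v)).comp hv).pair
      (hv.pair (ha.pair (hb.pair (hc.pair hd))))
  | halt =>
    exact (Primrec.const none).pair (hv.pair (ha.pair (hb.pair (hc.pair hd))))

theorem primrec_stepTuple (S : Finset Λ') : Primrec (stepTuple S) := by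
  have h2 : Primrec fun x : Tuple S => x.2.2 := Primrec.snd.comp Primrec.snd
  have h3 : Primrec fun x : Tuple S => x.2.2.2 := Primrec.snd.comp h2
  have h4 : Primrec fun x : Tuple S => x.2.2.2.2 := Primrec.snd.comp h3
  have hstep : Primrec₂ fun (l : S) (x : Tuple S) => toTuple S (TM2.stepAux (tr l) x.2.1
      (K'.elim x.2.2.1 x.2.2.2.1 x.2.2.2.2.1 x.2.2.2.2.2)) :=
    Primrec.of_finite_fst fun l => primrec_toTuple_stepAux S (tr l)
      (Primrec.fst.comp Primrec.snd) (Primrec.fst.comp h2) (Primrec.fst.comp h3)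
      (Primrec.fst.comp h4) (Primrec.snd.comp h4)
  refine (Primrec.option_casesOn Primrec.fst Primrec.id
    (hstep.comp Primrec.snd Primrec.fst).to₂).of_eq fun x => ?_
  unfold stepTuple
  cases x.1 <;> rfl

/-- One step of the machine; halting configurations are fixed. -/
def stepD (c : Cfg') : Cfg' := (TM2.step tr c).getD c

theorem stepD_of_halted {c : Cfg'} (hc : c.l = none) : stepD c = c := by
  obtain ⟨l, v, S⟩ := c
  obtain rfl : l = none := hc
  rfl

theorem elim_stk (S : K' → List Γ') :
    K'.elim (S .main) (S .rev) (S .aux) (S .stack) = S := by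
  funext k; cases k <;> rfl

/-- The finitely many labels that the machine for `code` can reach. -/
abbrev labels (code : Code) : Finset Λ' := codeSupp code Cont'.halt

theorem stepD_mem (code : Code) {c : Cfg'} (hc : c.l ∈ Finset.insertNone (labels code)) :
    (stepD c).l ∈ Finset.insertNone (labels code) := by
  obtain ⟨_ | l, v, S⟩ := c
  · exact hc
  · exact @TM2.step_supports _ _ _ _ ⟨trNormal code Cont'.halt⟩ _ tr _
      (tr_supports code Cont'.halt) _ _ rfl hc

theorem stepTuple_toTuple (code : Code) {c : Cfg'} (hc : c.l ∈ Finset.insertNone (labels code)) :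
    stepTuple (labels code) (toTuple (labels code) c) = toTuple (labels code) (stepD c) := by
  obtain ⟨_ | l, v, S⟩ := c
  · rfl
  · have hl : l ∈ labels code := by simpa using hc
    have h : toTuple (labels code) (⟨some l, v, S⟩ : Cfg') =
        (some ⟨l, hl⟩, v, S .main, S .rev, S .aux, S .stack) := by
      simp [toTuple, restrictLabel, hl]
    rw [h]
    simp only [stepTuple, elim_stk]
    rfl

theorem iterate_stepTuple (code : Code) (t : ℕ) {c : Cfg'}
    (hc : c.l ∈ Finset.insertNone (labels code)) :
    (stepTuple (labels code))^[t] (toTuple (labels code) c) =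
      toTuple (labels code) (stepD^[t] c) := by
  induction t generalizing c with
  | zero => rfl
  | succ t ih =>
    rw [Function.iterate_succ_apply, Function.iterate_succ_apply, stepTuple_toTuple code hc,
      ih (stepD_mem code hc)]

theorem iterate_stepD_mem (code : Code) (t : ℕ) {c : Cfg'}
    (hc : c.l ∈ Finset.insertNone (labels code)) :
    (stepD^[t] c).l ∈ Finset.insertNone (labels code) := by
  induction t generalizing c with
  | zero => exact hc
  | succ t ih =>
    rw [Function.iterate_succ_apply]
    exact ih (stepD_mem code hc)

theorem iterate_stepD_of_halted {c : Cfg'} (hc : c.l = none) (t : ℕ) : stepD^[t] c = c :=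
  Function.iterate_fixed (stepD_of_halted hc) t

theorem iterate_stepD_mono {c : Cfg'} {t u : ℕ} (h : (stepD^[t] c).l = none) (htu : t ≤ u) :
    stepD^[u] c = stepD^[t] c := by
  obtain ⟨w, rfl⟩ := Nat.exists_eq_add_of_le' htu
  rw [Function.iterate_add_apply, iterate_stepD_of_halted h]

theorem init_mem (code : Code) (v : List ℕ) :
    (init code v).l ∈ Finset.insertNone (labels code) := by
  refine Finset.some_mem_insertNone.2 ?_
  exact (tr_supports code Cont'.halt).1

theorem exists_iterate_stepD_init {code : Code} {v w : List ℕ} (h : code.eval v = pure w) :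
    ∃ t, stepD^[t] (init code v) = halt w := by
  have hev := tr_eval code v
  rw [h] at hev
  have hmem : halt w ∈ StateTransition.eval (TM2.step tr) (init code v) := by
    rw [hev]
    exact Part.mem_map halt (Part.mem_some w)
  have hr := (StateTransition.mem_eval.1 hmem).1
  generalize init code v = c at hr
  induction hr using Relation.ReflTransGen.head_induction_on with
  | refl => exact ⟨0, rfl⟩
  | head hab _ ih =>
    obtain ⟨t, ht⟩ := ih
    refine ⟨t + 1, ?_⟩
    rw [Function.iterate_succ_apply, stepD, Option.mem_def.1 hab]
    exact ht

theorem iterate_stepD_init_eq {code : Code} {v w : List ℕ} (h : code.eval v = pure w) {t : ℕ}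
    (ht : (stepD^[t] (init code v)).l = none) : stepD^[t] (init code v) = halt w := by
  obtain ⟨u, hu⟩ := exists_iterate_stepD_init h
  rcases le_total t u with htu | htu
  · rw [← hu, iterate_stepD_mono ht htu]
  · rw [iterate_stepD_mono (by rw [hu]; rfl) htu, hu]

/-- A bit as a symbol of the alphabet of the machine. -/
def ofBit (b : Bool) : Γ' := if b then .bit1 else .bit0

theorem trPosNum_bitsToPosNum (s : List Bool) :
    trPosNum (bitsToPosNum s) = s.map ofBit ++ [.bit1] := by
  induction s with
  | nil => rfl
  | cons b s ih => cases b <;> simp [bitsToPosNum, trPosNum, ih, ofBit]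

/-- The terminal one makes the initial stack of the brute force machine the input string itself,
followed by two fixed symbols. Leading zeros survive, and the input needs only to be copied. -/
theorem trList_bitsToNat (s : List Bool) :
    trList [bitsToNat s] = s.map ofBit ++ [.bit1, .cons] := by
  have h : trNat (bitsToNat s) = trPosNum (bitsToPosNum s) := by
    rw [trNat, bitsToNat, PosNum.of_to_nat]
    rfl
  simp [h, trPosNum_bitsToPosNum]

/-- The `m` lowest binary digits of `N`. -/
def lowBits (m N : ℕ) : List Bool :=
  (List.range m).map fun i => decide (natDigit 2 N i = 1)

theorem exists_lowBits_eq (s : List Bool) : ∃ N < 2 ^ s.length, lowBits s.length N = s := by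
  obtain ⟨N, hN, h⟩ := exists_natDigit_two_iff (m := s.length) fun i => s[i]? = some true
  refine ⟨N, hN, List.ext_getElem (by simp [lowBits]) fun i hi hi' => ?_⟩
  simp only [lowBits, List.getElem_map, List.getElem_range, h i hi', List.getElem?_eq_getElem hi']
  simp

/-- The machine for `code` halts within `t` steps on every bit string of length less than `m`. -/
def HaltsOnShort (code : Code) (m t : ℕ) : Prop :=
  ∀ i < m, ∀ N < 2 ^ i, (stepD^[t] (init code [bitsToNat (lowBits i N)])).l = none

/-- Only finitely many labels are reachable, so the machine can be simulated by iterating a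
primitive recursive map on tuples; the quantifiers over inputs are bounded. -/
theorem primrecPred_haltsOnShort (code : Code) :
    PrimrecPred fun x : ℕ × ℕ => HaltsOnShort code x.1 x.2 := by
  have hbits : Primrec fun y : ((ℕ × ℕ) × ℕ) × ℕ => (lowBits y.1.2 y.2).map ofBit := by
    refine Primrec.list_map (Primrec.list_map (Primrec.list_range.comp
      (Primrec.snd.comp Primrec.fst)) ?_) ((Primrec.dom_finite ofBit).comp Primrec.snd).to₂
    exact (primrecRel_natDigit_two.comp (Primrec.snd.comp Primrec.fst) Primrec.snd).decide
  have hinit : Primrec fun y : ((ℕ × ℕ) × ℕ) × ℕ =>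
      toTuple (labels code) (init code [bitsToNat (lowBits y.1.2 y.2)]) := by
    refine ((Primrec.const (restrictLabel (labels code) (trNormal code Cont'.halt))).pair
      ((Primrec.const none).pair ((Primrec.list_append.comp hbits
        (Primrec.const [.bit1, .cons])).pair ((Primrec.const []).pair
          ((Primrec.const []).pair (Primrec.const [])))))).of_eq fun y => ?_
    rw [init, trList_bitsToNat]
    rfl
  refine .forall_lt_bound Primrec.fst ?_
  refine .forall_lt_bound (Primrec.nat_pow.comp (Primrec.const 2) Primrec.snd) ?_
  refine (Primrec.eq.comp (Primrec.fst.comp (Primrec.nat_iterate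
    (Primrec.snd.comp (Primrec.fst.comp Primrec.fst)) hinit
    ((primrec_stepTuple (labels code)).comp Primrec.snd).to₂)) (Primrec.const none)).of_eq
    fun y => ?_
  rw [iterate_stepTuple code _ (init_mem code _),
    toTuple_fst_eq_none_iff (iterate_stepD_mem code _ (init_mem code _))]

/-- There are finitely many short strings and halted configurations stay fixed, so the maximum of
the individual halting times works. -/
theorem exists_haltsOnShort {code : Code} (h : ∀ N, ∃ w, code.eval [N] = pure w) (m : ℕ) :
    ∃ t, HaltsOnShort code m t := by
  have h1 : ∀ N, ∃ t, (stepD^[t] (init code [N])).l = none := fun N => by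
    obtain ⟨w, hw⟩ := h N
    obtain ⟨t, ht⟩ := exists_iterate_stepD_init hw
    exact ⟨t, by rw [ht]; rfl⟩
  choose τ hτ using h1
  refine ⟨(Finset.range m).sup fun i => (Finset.range (2 ^ i)).sup fun N =>
    τ (bitsToNat (lowBits i N)), fun i hi N hN => ?_⟩
  rw [iterate_stepD_mono (hτ _)]
  · exact hτ _
  · exact (Finset.le_sup (f := fun N => τ (bitsToNat (lowBits i N))) (Finset.mem_range.2 hN)).trans
      (Finset.le_sup (f := fun i => (Finset.range (2 ^ i)).sup fun N =>
        τ (bitsToNat (lowBits i N))) (Finset.mem_range.2 hi))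

/-- A machine that evaluates a total function halts within a number of steps that is a computable
function of the length of the input. -/
theorem exists_computable_time {code : Code} (h : ∀ N, ∃ w, code.eval [N] = pure w) :
    ∃ τ : ℕ → ℕ, Computable τ ∧ ∀ (s : List Bool) (m : ℕ), s.length < m →
      (stepD^[τ m] (init code [bitsToNat s])).l = none := by
  classical
  refine ⟨fun m => Nat.find (exists_haltsOnShort h m),
    Computable.of_find (primrecPred_haltsOnShort code)
      (fun m => Nat.find_spec (exists_haltsOnShort h m))
      fun m t ht => Nat.find_min (exists_haltsOnShort h m) ht, fun s m hm => ?_⟩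
  obtain ⟨N, hN, hs⟩ := exists_lowBits_eq s
  have := Nat.find_spec (exists_haltsOnShort h m) _ hm N hN
  rwa [hs] at this

theorem exists_code_of_primrecPred {Y : ℕ → Prop} (hY : PrimrecPred Y) :
    ∃ code : Code, ∀ N, (Y N → code.eval [N] = pure [1]) ∧ (¬ Y N → code.eval [N] = pure [0]) := by
  classical
  have hf : Primrec fun N => if Y N then 1 else 0 :=
    Primrec.ite hY (Primrec.const 1) (Primrec.const 0)
  obtain ⟨code, hcode⟩ := Code.exists_code (Nat.Partrec'.part_iff₁.2 hf.to_comp.partrec)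
  refine ⟨code, fun N => ?_⟩
  have := hcode (N ::ᵥ List.Vector.nil)
  constructor <;> intro hN <;> refine this.trans ?_ <;> simp [hN]

end Turing.PartrecToTM2

/-! ### A machine that separates large and small instances -/

/-- The machine with step function `f` gets from `a` to `b` in at most `t` steps. -/
def RunsTo {σ : Type*} (f : σ → Option σ) (t : ℕ) (a b : σ) : Prop :=
  Nonempty (StateTransition.EvalsToInTime f a (some b) t)

namespace RunsTo

variable {σ : Type*} {f : σ → Option σ} {a b c : σ} {t u : ℕ}

theorem refl (f : σ → Option σ) (a : σ) : RunsTo f 0 a a :=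
  ⟨.refl f a⟩

theorem trans (h₁ : RunsTo f t a b) (h₂ : RunsTo f u b c) : RunsTo f (t + u) a c := by
  obtain ⟨h₁⟩ := h₁
  obtain ⟨h₂⟩ := h₂
  exact ⟨add_comm u t ▸ StateTransition.EvalsToInTime.trans f t u a b (some c) h₁ h₂⟩

theorem single (h : f a = some b) : RunsTo f 1 a b :=
  ⟨⟨⟨1, h⟩, le_rfl⟩⟩

theorem head (h : f a = some b) (h' : RunsTo f t b c) : RunsTo f (t + 1) a c :=
  add_comm 1 t ▸ (single h).trans h'

theorem mono (h : RunsTo f t a b) (htu : t ≤ u) : RunsTo f u a b := by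
  obtain ⟨h⟩ := h
  exact ⟨⟨h.toEvalsTo, h.steps_le_m.trans htu⟩⟩

end RunsTo

namespace SizeTest

open Turing Turing.TM2.Stmt Turing.PartrecToTM2

/-- The stacks that the machine has beyond those of the machine for the brute force algorithm: the
input and output, the reversed part of the input that has been read, and three counters. -/
inductive Aux
  | io
  | seen
  | cnt
  | tmp
  | rows
  deriving DecidableEq

instance : Fintype Aux :=
  ⟨{.io, .seen, .cnt, .tmp, .rows}, by rintro (_ | _ | _ | _ | _) <;> simp⟩

/-- The labels of the part of the machine that parses the input and tests the size of the graph. -/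
inductive Lab
  | header
  | row
  | col
  | refillRow
  | digit
  | divide
  | refillDigit
  | test
  | load
  | clearCnt
  | clearSeen
  | answer
  deriving DecidableEq

instance : Fintype Lab :=
  ⟨{.header, .row, .col, .refillRow, .digit, .divide, .refillDigit, .test, .load, .clearCnt,
    .clearSeen, .answer}, by
      rintro (_ | _ | _ | _ | _ | _ | _ | _ | _ | _ | _ | _) <;> simp⟩

/-- The stack alphabets. -/
abbrev Alphabet : K' ⊕ Aux → Type
  | .inl _ => Γ'
  | .inr _ => Bool

/-- The labels of the whole machine. -/
abbrev Label (S : Finset Λ') : Type := Lab ⊕ S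

/-- The statements of the whole machine. -/
abbrev Program (S : Finset Λ') : Type := TM2.Stmt Alphabet (Label S) (Option Γ')

/-- The configurations of the whole machine. -/
abbrev Config (S : Finset Λ') : Type := TM2.Cfg Alphabet (Label S) (Option Γ')

variable {S : Finset Λ'}

/-- Pop a bit from an auxiliary stack into the local store. -/
def popBit (k : Aux) (q : Program S) : Program S :=
  pop (.inr k) (fun _ (o : Option Bool) => o.map ofBit) q

/-- Push the bit in the local store onto an auxiliary stack. -/
def pushBit (k : Aux) (q : Program S) : Program S :=
  push (.inr k) (fun v => (decide (v = some .bit1) : Bool)) q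

/-- Pop an auxiliary stack and branch according to whether it was empty. -/
def popCase (k : Aux) (q₁ q₂ : Program S) : Program S :=
  popBit k (branch Option.isNone q₁ q₂)

/-- Jump to a fixed label. -/
def jump (l : Lab) : Program S := goto fun _ => .inl l

open Classical in
/-- The label of the whole machine that corresponds to a label of the brute force machine. -/
noncomputable def embedLabel (S : Finset Λ') (l : Λ') : Label S :=
  if h : l ∈ S then .inr ⟨l, h⟩ else .inl .answer

/-- A statement of the brute force machine as a statement of the whole machine. -/
noncomputable def embedStmt (S : Finset Λ') :
    TM2.Stmt (fun _ : K' => Γ') Λ' (Option Γ') → Program S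
  | push k f q => push (.inl k) f (embedStmt S q)
  | peek k f q => peek (.inl k) f (embedStmt S q)
  | pop k f q => pop (.inl k) f (embedStmt S q)
  | load f q => load f (embedStmt S q)
  | branch f q₁ q₂ => branch f (embedStmt S q₁) (embedStmt S q₂)
  | goto f => goto fun v => embedLabel S (f v)
  | .halt => goto fun _ => .inl .answer

/-- The program. The brute force machine is started at the label `start`. -/
noncomputable def program (S : Finset Λ') (start : Λ') : Label S → Program S
  | .inl .header => popBit .io <| branch (fun v => decide (v = some .bit1))
      (pushBit .seen <| pushBit .cnt <| pushBit .rows <| jump .header) (pushBit .seen <| jump .row)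
  | .inl .row => popCase .rows (jump .digit) (jump .col)
  | .inl .col => popCase .cnt (jump .refillRow)
      (pushBit .tmp <| popBit .io <| pushBit .seen <| jump .col)
  | .inl .refillRow => popCase .tmp (jump .row) (pushBit .cnt <| jump .refillRow)
  | .inl .digit => popCase .io (jump .test) (pushBit .seen <| jump .divide)
  | .inl .divide => (popBit .cnt)^[63] <|
      popCase .cnt (jump .refillDigit) (pushBit .tmp <| jump .divide)
  | .inl .refillDigit => popCase .tmp (jump .digit) (pushBit .cnt <| jump .refillDigit)
  | .inl .test => popCase .cnt
      (push (.inl .main) (fun _ => Γ'.cons) <| push (.inl .main) (fun _ => Γ'.bit1) <| jump .load)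
      (jump .clearCnt)
  | .inl .load => popCase .seen (goto fun _ => embedLabel S start)
      (push (.inl .main) (fun v => v.getD .cons) <| jump .load)
  | .inl .clearCnt => popCase .cnt (jump .clearSeen) (jump .clearCnt)
  | .inl .clearSeen => popCase .seen (push (.inr .io) (fun _ => true) .halt) (jump .clearSeen)
  | .inl .answer => pop (.inl .main) (fun _ o => o) <| branch (fun v => decide (v = some .bit1))
      (pop (.inl .main) (fun _ _ => none) <| push (.inr .io) (fun _ => true) .halt)
      (load (fun _ => none) <| push (.inr .io) (fun _ => false) .halt)
  | .inr l => embedStmt S (tr l)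

/-- The contents of the stacks; the counters are in unary. -/
def tapes (W : K' → List Γ') (io seen : List Bool) (cnt tmp rows : ℕ) :
    ∀ k, List (Alphabet k)
  | .inl k => W k
  | .inr .io => io
  | .inr .seen => seen
  | .inr .cnt => List.replicate cnt true
  | .inr .tmp => List.replicate tmp true
  | .inr .rows => List.replicate rows true

/-! ### The effect of single stack operations. -/

section Tapes

variable (W : K' → List Γ') (io seen : List Bool) (cnt tmp rows : ℕ)

@[simp]
theorem update_tapes_inl (k : K') (l : List Γ') :
    Function.update (tapes W io seen cnt tmp rows) (.inl k) l =
      tapes (Function.update W k l) io seen cnt tmp rows := by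
  funext k'
  rcases k' with k' | (_ | _ | _ | _ | _)
  · by_cases h : k' = k
    · subst h; simp [tapes]
    · simp [tapes, h]
  all_goals simp [tapes]

theorem update_tapes_io (l : List Bool) :
    Function.update (tapes W io seen cnt tmp rows) (.inr .io) l =
      tapes W l seen cnt tmp rows := by
  funext k'
  rcases k' with k' | (_ | _ | _ | _ | _) <;> simp [tapes]

theorem update_tapes_seen (l : List Bool) :
    Function.update (tapes W io seen cnt tmp rows) (.inr .seen) l =
      tapes W io l cnt tmp rows := by
  funext k'
  rcases k' with k' | (_ | _ | _ | _ | _) <;> simp [tapes]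

theorem update_tapes_cnt (n : ℕ) :
    Function.update (tapes W io seen cnt tmp rows) (.inr .cnt) (List.replicate n true) =
      tapes W io seen n tmp rows := by
  funext k'
  rcases k' with k' | (_ | _ | _ | _ | _) <;> simp [tapes]

theorem update_tapes_tmp (n : ℕ) :
    Function.update (tapes W io seen cnt tmp rows) (.inr .tmp) (List.replicate n true) =
      tapes W io seen cnt n rows := by
  funext k'
  rcases k' with k' | (_ | _ | _ | _ | _) <;> simp [tapes]

theorem update_tapes_rows (n : ℕ) :
    Function.update (tapes W io seen cnt tmp rows) (.inr .rows) (List.replicate n true) =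
      tapes W io seen cnt tmp n := by
  funext k'
  rcases k' with k' | (_ | _ | _ | _ | _) <;> simp [tapes]

@[simp] theorem tapes_inl (k : K') : tapes W io seen cnt tmp rows (.inl k) = W k := rfl

variable (q : Program S) (v : Option Γ')

@[simp]
theorem stepAux_popBit_io_nil :
    TM2.stepAux (popBit .io q) v (tapes W [] seen cnt tmp rows) =
      TM2.stepAux q none (tapes W [] seen cnt tmp rows) :=
  congrArg (TM2.stepAux q none) (update_tapes_io W [] seen cnt tmp rows [])

@[simp]
theorem stepAux_popBit_io_cons (b : Bool) :
    TM2.stepAux (popBit .io q) v (tapes W (b :: io) seen cnt tmp rows) =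
      TM2.stepAux q (some (ofBit b)) (tapes W io seen cnt tmp rows) :=
  congrArg (TM2.stepAux q (some (ofBit b)))
    (update_tapes_io W (b :: io) seen cnt tmp rows io)

@[simp]
theorem stepAux_popBit_seen_nil :
    TM2.stepAux (popBit .seen q) v (tapes W io [] cnt tmp rows) =
      TM2.stepAux q none (tapes W io [] cnt tmp rows) :=
  congrArg (TM2.stepAux q none) (update_tapes_seen W io [] cnt tmp rows [])

@[simp]
theorem stepAux_popBit_seen_cons (b : Bool) :
    TM2.stepAux (popBit .seen q) v (tapes W io (b :: seen) cnt tmp rows) =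
      TM2.stepAux q (some (ofBit b)) (tapes W io seen cnt tmp rows) :=
  congrArg (TM2.stepAux q (some (ofBit b)))
    (update_tapes_seen W io (b :: seen) cnt tmp rows seen)

@[simp]
theorem stepAux_popBit_cnt_zero :
    TM2.stepAux (popBit .cnt q) v (tapes W io seen 0 tmp rows) =
      TM2.stepAux q none (tapes W io seen 0 tmp rows) :=
  congrArg (TM2.stepAux q none) (update_tapes_cnt W io seen 0 tmp rows 0)

@[simp]
theorem stepAux_popBit_cnt_succ :
    TM2.stepAux (popBit .cnt q) v (tapes W io seen (cnt + 1) tmp rows) =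
      TM2.stepAux q (some .bit1) (tapes W io seen cnt tmp rows) :=
  congrArg (TM2.stepAux q (some .bit1)) (update_tapes_cnt W io seen (cnt + 1) tmp rows cnt)

@[simp]
theorem stepAux_pushBit_cnt :
    TM2.stepAux (pushBit .cnt q) (some .bit1) (tapes W io seen cnt tmp rows) =
      TM2.stepAux q (some .bit1) (tapes W io seen (cnt + 1) tmp rows) :=
  congrArg (TM2.stepAux q (some .bit1)) (update_tapes_cnt W io seen cnt tmp rows (cnt + 1))

@[simp]
theorem stepAux_popBit_tmp_zero :
    TM2.stepAux (popBit .tmp q) v (tapes W io seen cnt 0 rows) =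
      TM2.stepAux q none (tapes W io seen cnt 0 rows) :=
  congrArg (TM2.stepAux q none) (update_tapes_tmp W io seen cnt 0 rows 0)

@[simp]
theorem stepAux_popBit_tmp_succ :
    TM2.stepAux (popBit .tmp q) v (tapes W io seen cnt (tmp + 1) rows) =
      TM2.stepAux q (some .bit1) (tapes W io seen cnt tmp rows) :=
  congrArg (TM2.stepAux q (some .bit1)) (update_tapes_tmp W io seen cnt (tmp + 1) rows tmp)

@[simp]
theorem stepAux_pushBit_tmp :
    TM2.stepAux (pushBit .tmp q) (some .bit1) (tapes W io seen cnt tmp rows) =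
      TM2.stepAux q (some .bit1) (tapes W io seen cnt (tmp + 1) rows) :=
  congrArg (TM2.stepAux q (some .bit1)) (update_tapes_tmp W io seen cnt tmp rows (tmp + 1))

@[simp]
theorem stepAux_popBit_rows_zero :
    TM2.stepAux (popBit .rows q) v (tapes W io seen cnt tmp 0) =
      TM2.stepAux q none (tapes W io seen cnt tmp 0) :=
  congrArg (TM2.stepAux q none) (update_tapes_rows W io seen cnt tmp 0 0)

@[simp]
theorem stepAux_popBit_rows_succ :
    TM2.stepAux (popBit .rows q) v (tapes W io seen cnt tmp (rows + 1)) =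
      TM2.stepAux q (some .bit1) (tapes W io seen cnt tmp rows) :=
  congrArg (TM2.stepAux q (some .bit1)) (update_tapes_rows W io seen cnt tmp (rows + 1) rows)

@[simp]
theorem stepAux_pushBit_rows :
    TM2.stepAux (pushBit .rows q) (some .bit1) (tapes W io seen cnt tmp rows) =
      TM2.stepAux q (some .bit1) (tapes W io seen cnt tmp (rows + 1)) :=
  congrArg (TM2.stepAux q (some .bit1)) (update_tapes_rows W io seen cnt tmp rows (rows + 1))

theorem decide_ofBit (b : Bool) : decide (some (ofBit b) = some .bit1) = b := by
  cases b <;> rfl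

@[simp]
theorem stepAux_pushBit_seen (b : Bool) :
    TM2.stepAux (pushBit .seen q) (some (ofBit b)) (tapes W io seen cnt tmp rows) =
      TM2.stepAux q (some (ofBit b)) (tapes W io (b :: seen) cnt tmp rows) := by
  rw [pushBit, TM2.stepAux, decide_ofBit]
  exact congrArg (TM2.stepAux q _) (update_tapes_seen W io seen cnt tmp rows (b :: seen))

end Tapes

/-! ### Step counts for the loops of the machine. -/

section Runs

variable {start : Λ'} {W : K' → List Γ'} {io seen : List Bool} {cnt tmp rows : ℕ} {v : Option Γ'}

/-- The configuration of the machine at a label of its first part. -/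
def cfgAt (S : Finset Λ') (l : Lab) (v : Option Γ') (W : K' → List Γ') (io seen : List Bool)
    (cnt tmp rows : ℕ) : Config S :=
  ⟨some (.inl l), v, tapes W io seen cnt tmp rows⟩

theorem run_header (n : ℕ) :
    RunsTo (TM2.step (program S start)) (n + 1)
      (cfgAt S .header v W (List.replicate n true ++ false :: io) seen cnt tmp rows)
      (cfgAt S .row (some .bit0) W io (false :: (List.replicate n true ++ seen)) (cnt + n) tmp
        (rows + n)) := by
  induction n generalizing v seen cnt rows with
  | zero =>
    refine .single ?_
    simp [cfgAt, program, jump]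
    simp [ofBit]
  | succ n ih =>
    refine .head (b := cfgAt S .header (some .bit1) W (List.replicate n true ++ false :: io)
      (true :: seen) (cnt + 1) tmp (rows + 1)) ?_ ?_
    · simp [cfgAt, program, jump, List.replicate_succ]
      simp [ofBit]
    · rw [show cnt + (n + 1) = cnt + 1 + n by omega, show rows + (n + 1) = rows + 1 + n by omega,
        show List.replicate (n + 1) true ++ seen = List.replicate n true ++ true :: seen by
          rw [List.replicate_succ', List.append_assoc]; rfl]
      exact ih

theorem run_col (l : List Bool) :
    RunsTo (TM2.step (program S start)) (l.length + 1)
      (cfgAt S .col v W (l ++ io) seen l.length tmp rows)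
      (cfgAt S .refillRow none W io (l.reverse ++ seen) 0 (tmp + l.length) rows) := by
  induction l generalizing v seen tmp with
  | nil =>
    refine .single ?_
    simp [cfgAt, program, popCase, jump]
  | cons b l ih =>
    refine .head (b := cfgAt S .col (some (ofBit b)) W (l ++ io) (b :: seen) l.length
      (tmp + 1) rows)
      ?_ ?_
    · cases b <;> simp [cfgAt, program, popCase, jump]
    · rw [List.reverse_cons, List.append_assoc, List.length_cons,
        show tmp + (l.length + 1) = tmp + 1 + l.length by omega]
      exact ih

theorem run_refillRow :
    RunsTo (TM2.step (program S start)) (tmp + 1)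
      (cfgAt S .refillRow v W io seen cnt tmp rows)
      (cfgAt S .row none W io seen (cnt + tmp) 0 rows) := by
  induction tmp generalizing v cnt with
  | zero =>
    refine .single ?_
    simp [cfgAt, program, popCase, jump]
  | succ tmp ih =>
    refine .head (b := cfgAt S .refillRow (some .bit1) W io seen (cnt + 1) tmp rows) ?_ ?_
    · simp [cfgAt, program, popCase, jump]
    · rw [show cnt + (tmp + 1) = cnt + 1 + tmp by omega]
      exact ih

/-- The matrix carries no delimiters, so its end is found by counting. For each row the counter
`cnt` is drained into `tmp` while bits are read and then refilled, which accounts for `2 * cnt + 3`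
steps. -/
theorem run_row (l : List Bool) (hl : l.length = rows * cnt) :
    RunsTo (TM2.step (program S start)) (rows * (2 * cnt + 3) + 1)
      (cfgAt S .row v W (l ++ io) seen cnt 0 rows)
      (cfgAt S .digit none W io (l.reverse ++ seen) cnt 0 0) := by
  induction rows generalizing v seen l with
  | zero =>
    obtain rfl : l = [] := List.length_eq_zero_iff.1 (by simpa using hl)
    rw [zero_mul, zero_add]
    refine .single ?_
    simp [cfgAt, program, popCase, jump]
  | succ rows ih =>
    obtain ⟨l₁, l₂, rfl, h₁, h₂⟩ : ∃ l₁ l₂, l = l₁ ++ l₂ ∧ l₁.length = cnt ∧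
        l₂.length = rows * cnt := by
      rw [Nat.succ_mul] at hl
      exact ⟨l.take cnt, l.drop cnt, (List.take_append_drop _ _).symm, by simp; omega,
        by simp; omega⟩
    have e₁ : RunsTo (TM2.step (program S start)) 1
        (cfgAt S .row v W (l₁ ++ l₂ ++ io) seen cnt 0 (rows + 1))
        (cfgAt S .col (some .bit1) W (l₁ ++ (l₂ ++ io)) seen cnt 0 rows) := by
      refine .single ?_
      simp [cfgAt, program, popCase, jump]
    subst h₁
    have e₂ := run_col (S := S) (start := start) (v := some .bit1) (W := W) (io := l₂ ++ io)
      (seen := seen) (tmp := 0) (rows := rows) l₁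
    have e₃ := run_refillRow (S := S) (start := start) (v := none) (W := W) (io := l₂ ++ io)
      (seen := l₁.reverse ++ seen) (cnt := 0) (tmp := 0 + l₁.length) (rows := rows)
    have e₄ := ih (v := none) (seen := l₁.reverse ++ seen) l₂ h₂
    rw [zero_add] at e₂ e₃
    rw [zero_add] at e₃
    rw [List.reverse_append, List.append_assoc l₂.reverse]
    have h := Nat.add_one_mul rows (2 * l₁.length + 3)
    exact (((e₁.trans e₂).trans e₃).trans e₄).mono (by omega)

theorem stepAux_iterate_popBit (j : ℕ) (q : Program S) :
    ∃ v', TM2.stepAux ((popBit .cnt)^[j] q) v (tapes W io seen cnt tmp rows) =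
      TM2.stepAux q v' (tapes W io seen (cnt - j) tmp rows) := by
  induction j generalizing v cnt with
  | zero => exact ⟨v, rfl⟩
  | succ j ih =>
    rw [Function.iterate_succ_apply']
    cases cnt with
    | zero => simpa using ih (v := none) (cnt := 0)
    | succ cnt => simpa using ih (v := some .bit1) (cnt := cnt)

/-- One machine step pops 63 times and then tests a 64th pop; only if that succeeds is a unit added
to the quotient. Popping an empty stack is harmless, so a remainder below 64 is discarded. -/
theorem run_divide :
    RunsTo (TM2.step (program S start)) (cnt / 64 + 1)
      (cfgAt S .divide v W io seen cnt tmp rows)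
      (cfgAt S .refillDigit none W io seen 0 (tmp + cnt / 64) rows) := by
  induction cnt using Nat.strong_induction_on generalizing v tmp with
  | _ cnt ih =>
    obtain ⟨v', hv'⟩ := stepAux_iterate_popBit (v := v) (W := W) (io := io) (seen := seen)
      (cnt := cnt) (tmp := tmp) (rows := rows) 63
      (popCase .cnt (jump .refillDigit) (pushBit .tmp <| jump .divide) : Program S)
    have hstep : TM2.step (program S start) (cfgAt S .divide v W io seen cnt tmp rows) =
        some (TM2.stepAux (popCase .cnt (jump .refillDigit) (pushBit .tmp <| jump .divide)) v'
          (tapes W io seen (cnt - 63) tmp rows)) := congrArg some hv'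
    rcases lt_or_ge cnt 64 with h | h
    · rw [Nat.div_eq_of_lt h]
      refine .single (hstep.trans ?_)
      rw [show cnt - 63 = 0 by omega]
      simp [cfgAt, popCase, jump]
    · obtain ⟨c, rfl⟩ := Nat.exists_eq_add_of_le' h
      rw [show (c + 64) / 64 = c / 64 + 1 by omega,
        show tmp + (c / 64 + 1) = tmp + 1 + c / 64 by omega]
      refine .head (b := cfgAt S .divide (some .bit1) W io seen c (tmp + 1) rows) (hstep.trans ?_)
        (ih c (by omega))
      rw [show c + 64 - 63 = c + 1 by omega]
      simp [cfgAt, popCase, jump]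

theorem run_refillDigit :
    RunsTo (TM2.step (program S start)) (tmp + 1)
      (cfgAt S .refillDigit v W io seen cnt tmp rows)
      (cfgAt S .digit none W io seen (cnt + tmp) 0 rows) := by
  induction tmp generalizing v cnt with
  | zero =>
    refine .single ?_
    simp [cfgAt, program, popCase, jump]
  | succ tmp ih =>
    refine .head (b := cfgAt S .refillDigit (some .bit1) W io seen (cnt + 1) tmp rows) ?_ ?_
    · simp [cfgAt, program, popCase, jump]
    · rw [show cnt + (tmp + 1) = cnt + 1 + tmp by omega]
      exact ih

theorem run_digit (d : List Bool) :
    RunsTo (TM2.step (program S start)) (d.length * (2 * cnt + 3) + 1)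
      (cfgAt S .digit v W d seen cnt 0 rows)
      (cfgAt S .test none W [] (d.reverse ++ seen) (cnt / 64 ^ d.length) 0 rows) := by
  induction d generalizing v seen cnt with
  | nil =>
    rw [List.length_nil, zero_mul, zero_add]
    refine .single ?_
    simp [cfgAt, program, popCase, jump]
  | cons b d ih =>
    have e₁ : RunsTo (TM2.step (program S start)) 1
        (cfgAt S .digit v W (b :: d) seen cnt 0 rows)
        (cfgAt S .divide (some (ofBit b)) W d (b :: seen) cnt 0 rows) := by
      refine .single ?_
      cases b <;> simp [cfgAt, program, popCase, jump]
    have e₂ := run_divide (S := S) (start := start) (v := some (ofBit b)) (W := W) (io := d)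
      (seen := b :: seen) (cnt := cnt) (tmp := 0) (rows := rows)
    have e₃ := run_refillDigit (S := S) (start := start) (v := none) (W := W) (io := d)
      (seen := b :: seen) (cnt := 0) (tmp := 0 + cnt / 64) (rows := rows)
    have e₄ := ih (v := none) (seen := b :: seen) (cnt := cnt / 64)
    rw [zero_add] at e₂ e₃
    rw [zero_add] at e₃
    rw [List.reverse_cons, List.append_assoc, List.length_cons, pow_succ',
      ← Nat.div_div_eq_div_mul]
    refine (((e₁.trans e₂).trans e₃).trans e₄).mono ?_
    have h1 : d.length * (2 * (cnt / 64) + 3) ≤ d.length * (2 * cnt + 3) :=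
      Nat.mul_le_mul_left _ (by omega)
    have h2 := Nat.add_one_mul d.length (2 * cnt + 3)
    omega

theorem run_load {a : List Γ'} :
    RunsTo (TM2.step (program S start)) (seen.length + 1)
      (cfgAt S .load v (K'.elim a [] [] []) io seen cnt tmp rows)
      ⟨some (embedLabel S start), none,
        tapes (K'.elim (seen.reverse.map ofBit ++ a) [] [] []) io [] cnt tmp rows⟩ := by
  induction seen generalizing v a with
  | nil =>
    refine .single ?_
    simp [cfgAt, program, popCase]
  | cons b seen ih =>
    refine .head (b := cfgAt S .load (some (ofBit b)) (K'.elim (ofBit b :: a) [] [] []) io seen cnt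
      tmp rows) ?_ ?_
    · simp [cfgAt, program, popCase, jump]
    · rw [List.reverse_cons, List.map_append, List.append_assoc]
      exact ih

theorem run_clearCnt :
    RunsTo (TM2.step (program S start)) (cnt + 1)
      (cfgAt S .clearCnt v W io seen cnt tmp rows)
      (cfgAt S .clearSeen none W io seen 0 tmp rows) := by
  induction cnt generalizing v with
  | zero =>
    refine .single ?_
    simp [cfgAt, program, popCase, jump]
  | succ cnt ih =>
    refine .head (b := cfgAt S .clearCnt (some .bit1) W io seen cnt tmp rows) ?_ ih
    simp [cfgAt, program, popCase, jump]

theorem run_clearSeen :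
    RunsTo (TM2.step (program S start)) (seen.length + 1)
      (cfgAt S .clearSeen v W io seen cnt tmp rows)
      ⟨none, none, tapes W (true :: io) [] cnt tmp rows⟩ := by
  induction seen generalizing v with
  | nil =>
    refine .single ?_
    simp [cfgAt, program, popCase]
    exact update_tapes_io _ _ _ _ _ _ _
  | cons b seen ih =>
    refine .head (b := cfgAt S .clearSeen (some (ofBit b)) W io seen cnt tmp rows) ?_ ih
    simp [cfgAt, program, popCase, jump]

theorem run_test_zero {a : List Γ'} :
    RunsTo (TM2.step (program S start)) 1
      (cfgAt S .test v (K'.elim a [] [] []) io seen 0 tmp rows)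
      (cfgAt S .load none (K'.elim (.bit1 :: .cons :: a) [] [] []) io seen 0 tmp rows) := by
  refine .single ?_
  simp [cfgAt, program, popCase, jump]

theorem run_test_succ :
    RunsTo (TM2.step (program S start)) 1
      (cfgAt S .test v W io seen (cnt + 1) tmp rows)
      (cfgAt S .clearCnt (some .bit1) W io seen cnt tmp rows) := by
  refine .single ?_
  simp [cfgAt, program, popCase, jump]

theorem run_answer_one :
    RunsTo (TM2.step (program S start)) 1
      (cfgAt S .answer v (K'.elim (trList [1]) [] [] []) io seen cnt tmp rows)
      ⟨none, none, tapes (K'.elim [] [] [] []) (true :: io) seen cnt tmp rows⟩ := by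
  rw [show trList [1] = [.bit1, .cons] from rfl]
  refine .single ?_
  simp [cfgAt, program]
  exact update_tapes_io _ _ _ _ _ _ _

theorem run_answer_zero :
    RunsTo (TM2.step (program S start)) 1
      (cfgAt S .answer v (K'.elim (trList [0]) [] [] []) io seen cnt tmp rows)
      ⟨none, none, tapes (K'.elim [] [] [] []) (false :: io) seen cnt tmp rows⟩ := by
  rw [show trList [0] = [.cons] from rfl]
  refine .single ?_
  simp [cfgAt, program]
  exact update_tapes_io _ _ _ _ _ _ _

/-- A configuration of the brute force machine as a configuration of the whole machine. -/
noncomputable def embedCfg (S : Finset Λ') (c : Cfg') : Config S :=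
  ⟨some (c.l.elim (.inl .answer) (embedLabel S)), c.var, tapes c.stk [] [] 0 0 0⟩

theorem stepAux_embedStmt (q : TM2.Stmt (fun _ : K' => Γ') Λ' (Option Γ')) :
    TM2.stepAux (embedStmt S q) v (tapes W [] [] 0 0 0) = embedCfg S (TM2.stepAux q v W) := by
  induction q generalizing v W with
  | push k f q ih => simp [embedStmt, ih]
  | peek k f q ih => simp [embedStmt, ih]
  | pop k f q ih => simp [embedStmt, ih]
  | load f q ih => simp [embedStmt, ih]
  | branch f q₁ q₂ ih₁ ih₂ => cases h : f v <;> simp [embedStmt, ih₁, ih₂, h]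
  | goto f => simp [embedStmt, embedCfg]
  | halt => simp [embedStmt, embedCfg]

/-- The simulation is step by step. Halting becomes a jump to `answer`, where the whole machine has
yet to act, so idle iterations of `stepD` are dropped and `t` is only an upper bound. -/
theorem run_embedCfg (code : ToPartrec.Code) (t : ℕ) {c : Cfg'}
    (hc : c.l ∈ Finset.insertNone (labels code)) (hh : (stepD^[t] c).l = none) :
    RunsTo (TM2.step (program (labels code) start)) t (embedCfg (labels code) c)
      (embedCfg (labels code) (stepD^[t] c)) := by
  induction t generalizing c with
  | zero => exact .refl _ _
  | succ t ih =>
    rw [Function.iterate_succ_apply] at hh ⊢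
    cases hl : c.l with
    | none =>
      rw [stepD_of_halted hl] at hh ⊢
      exact (ih hc hh).mono t.le_succ
    | some l =>
      refine .head ?_ (ih (stepD_mem code hc) hh)
      obtain ⟨_, v, W⟩ := c
      obtain rfl : _ = some l := hl
      have hlS : l ∈ labels code := by simpa using hc
      have h := stepAux_embedStmt (S := labels code) (v := v) (W := W) (tr l)
      simp only [embedCfg, Option.elim_some, embedLabel, dif_pos hlS]
      exact congrArg some h

end Runs

/-- The whole machine for a given code. -/
noncomputable def machine (code : ToPartrec.Code) : FinTM2 where
  K := K' ⊕ Aux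
  k₀ := .inr .io
  k₁ := .inr .io
  Γ := Alphabet
  Λ := Label (labels code)
  main := .inl .header
  σ := Option Γ'
  initialState := none
  Γk₀Fin := inferInstanceAs (Fintype Bool)
  m := program (labels code) (trNormal code Cont'.halt)

/-- The whole machine with its alphabets. -/
noncomputable def computer (code : ToPartrec.Code) : TM2ComputableAux Bool Bool where
  tm := machine code
  inputAlphabet := Equiv.refl Bool
  outputAlphabet := Equiv.refl Bool

theorem initList_eq (code : ToPartrec.Code) (s : List Bool) :
    (initList (machine code) s : Config (labels code)) =
      cfgAt (labels code) .header none (K'.elim [] [] [] []) s [] 0 0 0 := by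
  refine congrArg (TM2.Cfg.mk _ _) ?_
  funext k
  rcases k with (_ | _ | _ | _) | (_ | _ | _ | _ | _) <;> rfl

/-- The output convention requires an empty local store and empty stacks apart from the output; this
is why both branches of the program clean up before halting. -/
theorem haltList_eq (code : ToPartrec.Code) (s : List Bool) :
    (haltList (machine code) s : Config (labels code)) =
      ⟨none, none, tapes (K'.elim [] [] [] []) s [] 0 0 0⟩ := by
  refine congrArg (TM2.Cfg.mk _ _) ?_
  funext k
  rcases k with (_ | _ | _ | _) | (_ | _ | _ | _ | _) <;> rfl

/-! ### Complete runs on large and on small instances. -/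

section Runs

variable {code : ToPartrec.Code}

/-- The first part of the machine parses its input and divides the number of vertices by `64` for
every binary digit of the second component of the input. -/
theorem run_parse (n : ℕ) (A d : List Bool) (hA : A.length = n * n) {start : Λ'}
    {S : Finset Λ'} :
    RunsTo (TM2.step (program S start)) ((n + 1) + (n * (2 * n + 3) + 1) +
        (d.length * (2 * n + 3) + 1))
      (cfgAt S .header none (K'.elim [] [] [] [])
        (List.replicate n true ++ [false] ++ A ++ d) [] 0 0 0)
      (cfgAt S .test none (K'.elim [] [] [] []) []
        (List.replicate n true ++ [false] ++ A ++ d).reverse (n / 64 ^ d.length) 0 0) := by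
  have e₁ := run_header (S := S) (start := start) (v := none) (W := K'.elim [] [] [] [])
    (io := A ++ d) (seen := []) (cnt := 0) (tmp := 0) (rows := 0) n
  rw [zero_add] at e₁
  have e₂ := run_row (S := S) (start := start) (v := some .bit0) (W := K'.elim [] [] [] [])
    (io := d) (seen := false :: (List.replicate n true ++ [])) (cnt := n) (rows := n) A hA
  have e₃ := run_digit (S := S) (start := start) (v := none) (W := K'.elim [] [] [] [])
    (seen := A.reverse ++ false :: (List.replicate n true ++ [])) (cnt := n) (rows := 0) d
  have h₁ : List.replicate n true ++ [false] ++ A ++ d =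
      List.replicate n true ++ false :: (A ++ d) := by simp
  have h₂ : (List.replicate n true ++ [false] ++ A ++ d).reverse =
      d.reverse ++ (A.reverse ++ false :: (List.replicate n true ++ [])) := by simp
  rw [h₂, h₁]
  exact (e₁.trans e₂).trans e₃

theorem run_small {s : List Bool} {b : Bool} {t : ℕ}
    (hb : code.eval [bitsToNat s] = pure [b.toNat])
    (ht : (stepD^[t] (init code [bitsToNat s])).l = none) :
    RunsTo (TM2.step (program (labels code) (trNormal code Cont'.halt))) (s.length + 3 + t)
      (cfgAt (labels code) .test none (K'.elim [] [] [] []) [] s.reverse 0 0 0)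
      ⟨none, none, tapes (K'.elim [] [] [] []) [b] [] 0 0 0⟩ := by
  have e₁ := run_test_zero (S := labels code) (start := trNormal code Cont'.halt) (v := none)
    (io := []) (seen := s.reverse) (tmp := 0) (rows := 0) (a := [])
  have e₂ := run_load (S := labels code) (start := trNormal code Cont'.halt) (v := none)
    (io := []) (seen := s.reverse) (cnt := 0) (tmp := 0) (rows := 0) (a := [.bit1, .cons])
  have e₃ := run_embedCfg (start := trNormal code Cont'.halt) code t
    (init_mem code [bitsToNat s]) ht
  rw [iterate_stepD_init_eq hb ht] at e₃
  have e₄ : RunsTo (TM2.step (program (labels code) (trNormal code Cont'.halt))) 1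
      (embedCfg (labels code) (PartrecToTM2.halt [b.toNat]))
      ⟨none, none, tapes (K'.elim [] [] [] []) [b] [] 0 0 0⟩ := by
    cases b
    · exact run_answer_zero
    · exact run_answer_one
  rw [List.reverse_reverse, ← trList_bitsToNat, List.length_reverse] at e₂
  exact (((e₁.trans e₂).trans e₃).trans e₄).mono (by omega)

theorem run_large {start : Λ'} {S : Finset Λ'} {s : List Bool} {c : ℕ} (hc : 0 < c) :
    RunsTo (TM2.step (program S start)) (s.length + c + 2)
      (cfgAt S .test none (K'.elim [] [] [] []) [] s.reverse c 0 0)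
      ⟨none, none, tapes (K'.elim [] [] [] []) [true] [] 0 0 0⟩ := by
  obtain ⟨c, rfl⟩ := Nat.exists_eq_succ_of_ne_zero hc.ne'
  have e₁ := run_test_succ (S := S) (start := start) (v := none) (W := K'.elim [] [] [] [])
    (io := []) (seen := s.reverse) (cnt := c) (tmp := 0) (rows := 0)
  have e₂ := run_clearCnt (S := S) (start := start) (v := some .bit1) (W := K'.elim [] [] [] [])
    (io := []) (seen := s.reverse) (cnt := c) (tmp := 0) (rows := 0)
  have e₃ := run_clearSeen (S := S) (start := start) (v := none) (W := K'.elim [] [] [] [])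
    (io := []) (seen := s.reverse) (cnt := 0) (tmp := 0) (rows := 0)
  rw [List.length_reverse] at e₃
  exact ((e₁.trans e₂).trans e₃).mono (by omega)

theorem outputs_of_runsTo {s : List Bool} {b : Bool} {t : ℕ}
    (h : RunsTo (TM2.step (program (labels code) (trNormal code Cont'.halt))) t
      (cfgAt (labels code) .header none (K'.elim [] [] [] []) s [] 0 0 0)
      ⟨none, none, tapes (K'.elim [] [] [] []) [b] [] 0 0 0⟩) :
    Nonempty (TM2OutputsInTime (computer code).tm
      (s.map (computer code).inputAlphabet.symm)
      (some ((Computability.encodeBool b).map (computer code).outputAlphabet.symm)) t) := by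
  have h₁ : s.map (computer code).inputAlphabet.symm = s := List.map_id s
  rw [h₁]
  exact Eq.mpr (congrArg₂ (RunsTo _ t) (initList_eq code s) (haltList_eq code [b])) h

end Runs

end SizeTest

/-! ### Assembly of the size test and the brute force machine. -/

open Turing.PartrecToTM2 SizeTest in
theorem mainTheorem7 (PG P : GraphProperty)
    (hPG : PG = GraphProperty.planar ∨ PG = GraphProperty.bipartite ∨
      PG = GraphProperty.triangleFree)
    (hP : P = GraphProperty.planar ∨ P = GraphProperty.bipartite ∨
      P = GraphProperty.triangleFree) :
    (inducedSubgraphProblem PG P).IsFPT := by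
  classical
  obtain ⟨Y, hY, hYes⟩ := exists_primrecPred_isYes PG hP
  obtain ⟨code, hcode⟩ := exists_code_of_primrecPred hY
  have heval : ∀ N, code.eval [N] = pure [(decide (Y N)).toNat] := fun N => by
    by_cases h : Y N
    · simpa [h] using (hcode N).1 h
    · simpa [h] using (hcode N).2 h
  obtain ⟨τ, hτ, hhalt⟩ := exists_computable_time fun N => ⟨_, heval N⟩
  -- A strict bound for the input length `n + 1 + n * n + l` when `n < 64 ^ k` and `k` has `l ≤ k`
  -- binary digits.
  let len : ℕ → ℕ := fun k => 64 ^ k + 64 ^ k * 64 ^ k + k + 2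
  have hlen : Primrec len := by
    have hp : Primrec fun k : ℕ => 64 ^ k := Primrec.nat_pow.comp (Primrec.const 64) Primrec.id
    exact Primrec.nat_add.comp (Primrec.nat_add.comp (Primrec.nat_add.comp hp
      (Primrec.nat_mul.comp hp hp)) Primrec.id) (Primrec.const 2)
  refine ⟨computer code, fun k => τ (len k) + 20, 2, ?_, fun I => ?_⟩
  · exact (Primrec.nat_add.comp Primrec.id (Primrec.const 20)).to_comp.comp
      (hτ.comp hlen.to_comp)
  change InducedSubgraphInstance PG at I
  change Nonempty (Turing.TM2OutputsInTime _ (I.encode.map _) _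
    ((τ (len I.k) + 20) * I.encode.length ^ 2))
  have hparse := run_parse I.n (adjacencyBits I.G) (Computability.encodeNat I.k)
    (length_adjacencyBits I.G) (start := trNormal code Cont'.halt) (S := labels code)
  have hL := I.length_encode
  have hk := length_encodeNat_le I.k
  set d := Computability.encodeNat I.k with hd
  -- Apart from `τ`, the total is at most `4m² + 9m + 6 ≤ 19m²` for an input of length `m ≥ 1`,
  -- which the constant 20 covers.
  have hbound : ∀ {u : ℕ}, u ≤ I.encode.length + I.n + 3 + τ (len I.k) →
      (I.n + 1) + (I.n * (2 * I.n + 3) + 1) + (d.length * (2 * I.n + 3) + 1) + u ≤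
        (τ (len I.k) + 20) * I.encode.length ^ 2 := by
    intro u hu
    set m := I.encode.length with hm
    have h1 : 1 ≤ m := by omega
    have h2 : I.n ≤ m := by omega
    have h3 : d.length ≤ m := by omega
    have h4 : I.n * (2 * I.n + 3) ≤ m * (2 * m + 3) := Nat.mul_le_mul h2 (by omega)
    have h5 : d.length * (2 * I.n + 3) ≤ m * (2 * m + 3) := Nat.mul_le_mul h3 (by omega)
    have h6 : m ≤ m ^ 2 := Nat.le_self_pow two_ne_zero m
    have h7 : τ (len I.k) ≤ τ (len I.k) * m ^ 2 := Nat.le_mul_of_pos_right _ (by positivity)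
    nlinarith
  by_cases hsize : I.n / 64 ^ d.length = 0
  · have hn : I.n < 64 ^ I.k := by
      have : I.n < 64 ^ d.length := by
        rcases Nat.div_eq_zero_iff.1 hsize with h | h
        · exact absurd h (by positivity)
        · exact h
      exact this.trans_le (Nat.pow_le_pow_right (by norm_num) hk)
    have hshort : I.encode.length < len I.k := by
      have := Nat.mul_le_mul hn.le hn.le
      simp only [len]
      omega
    have hrun := run_small (heval _) (hhalt I.encode (len I.k) hshort)
    rw [hsize] at hparse
    have hdec : decide (Y (bitsToNat I.encode)) =
        decide ((inducedSubgraphProblem PG P).IsYes I) := by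
      rw [decide_eq_decide]
      exact hYes I
    rw [hdec] at hrun
    exact outputs_of_runsTo ((hparse.trans hrun).mono (hbound (by omega)))
  · have hc := Nat.pos_of_ne_zero hsize
    have hrun := run_large (start := trNormal code Cont'.halt) (S := labels code)
      (s := I.encode) hc
    have hle : 64 ^ d.length ≤ I.n := (Nat.div_pos_iff.1 hc).2
    have hbig : (I.k + 1) ^ 6 ≤ I.n := by
      -- With `l` binary digits, `k + 1 ≤ 2 ^ l`, and `(2 ^ l) ^ 6 = 64 ^ l`; the divisor 64 was
      -- chosen to match the exponent 6.
      refine le_trans (Nat.pow_le_pow_left (lt_two_pow_length_encodeNat I.k) 6) ?_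
      rw [← pow_mul, mul_comm, pow_mul]
      exact hle
    have hyes : (inducedSubgraphProblem PG P).IsYes I :=
      GraphProperty.exists_induce_of_large hPG hP I.mem hbig
    have hq : I.n / 64 ^ d.length ≤ I.n := Nat.div_le_self _ _
    rw [← decide_eq_true hyes] at hrun
    exact outputs_of_runsTo ((hparse.trans hrun).mono (hbound (by omega)))
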